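/- Let $K$ be a field and let $k\geqslant 2$. All operads are symmetric, unital operads in $\mathbb{Z}$-graded $K$-vector spaces, with the Koszul sign rule; arity $0$ is allowed. For $x$ of arity $n$ and $\sigma\in\mathbb{S}_n$ let $x^\sigma(a_1,\dots,a_n)=x(a_{\sigma^{-1}(1)},\dots,a_{\sigma^{-1}(n)})$ (up to Koszul signs). Let $\mathrm{uGerst}_{(k-1)}$ be the operad encoding unital $(k-1)$-Gerstenhaber algebras. It is generated by $u$ of arity $0$ and degree $0$, $\mu$ of arity $2$ and degree $0$, and $\beta$ of arity $k$ and degree $1$, where $\mu$ and $\beta$ are invariant under $\mathbb{S}_2$ and $\mathbb{S}_k$ respectively, subject to the following relations. * Unit: $\mu\circ_1 u=\mathrm{id}$ and $\beta\circ_1 u=0$. * Associativity: $\mu\circ_1\mu=\mu\circ_2\mu$. * Leibniz: $\beta\circ_1\mu=(\mu\circ_1\beta)^{\sigma}+\mu\circ_2\beta$ with $\sigma^{-1}=(2\,3\,\cdots\,k\,k{+}1)$, that is, up to Koszul signs, $\beta(\mu(a_1,a_2),a_3,\dots,a_{k+1})=\mu(\beta(a_1,a_3,\dots,a_{k+1}),a_2)+\mu(a_1,\beta(a_2,\dots,a_{k+1}))$.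 * Jacobi: $\sum_{\sigma}(\beta\circ_1\beta)^\sigma=0$, the sum running over all $\sigma\in\mathbb{S}_{2k-1}$ whose inverse is a $(k,k-1)$-shuffle, that is, $\sigma^{-1}(1)<\dots<\sigma^{-1}(k)$ and $\sigma^{-1}(k+1)<\dots<\sigma^{-1}(2k-1)$. Put $\mu^{k-1}=\mu\circ_1\mu\circ_1\cdots\circ_1\mu$ ($k-1$ factors), an operation of arity $k$. A cocommutative Hopf operad structure on an operad $\mathcal{P}$ is a structure of graded, coassociative, counital, cocommutative coalgebra on every $\mathcal{P}(n)$ such that the symmetric group actions, the partial compositions $\circ_i:\mathcal{P}(n)\otimes\mathcal{P}(m)\to\mathcal{P}(n+m-1)$ and the unit $K\to\mathcal{P}(1)$ are morphisms of coalgebras; equivalently, it makes $\mathcal{P}$ an operad in the symmetric monoidal category of cocommutative coalgebras. **Lemma.** There is exactly one cocommutative Hopf operad structure on $\mathrm{uGerst}_{(k-1)}$ whose coproduct $\Delta$ satisfies $$\Delta(u)=u\otimes u,\qquad \Delta(\mu)=\mu\otimes\mu,\qquad \Delta(\beta)=\mu^{k-1}\otimes\beta+\beta\otimes\mu^{k-1}.$$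 -/

import Mathlib

open scoped TensorProduct DirectSum

/-! ### Positions of inputs in a partial composite

All inputs are numbered from `0`.  If `x` has `n` inputs and `y` has `m` inputs, the partial composite
`x ∘_i y` has `l = n + m - 1` inputs. -/

/-- The position, among the inputs of `x ∘_i y`, of the `j`-th input of `y`. -/
def inPos {n m l : ℕ} (i : Fin n) (h : n + m = l + 1) (j : Fin m) : Fin l :=
  ⟨i.1 + j.1, by omega⟩

/-- The position, among the inputs of `x ∘_i y`, of the `j`-th input of `x`, where `j ≠ i`. -/
def outPos {n m l : ℕ} (i : Fin n) (h : n + m = l + 1) (j : Fin n) (hj : j ≠ i) : Fin l :=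
  if hlt : j.1 < i.1 then ⟨j.1, by omega⟩
  else ⟨j.1 + m - 1, by
    have : j.1 ≠ i.1 := fun e => hj (Fin.ext e)
    omega⟩

/-- `ρ` is the permutation of the inputs of a composite induced by the permutations `σ`, `τ` of the
inputs of the two factors: in `(x · σ) ∘_i (y · τ) = (x ∘_{σ i} y) · ρ`. -/
def IsCompositePerm {n m l : ℕ} (i : Fin n) (h : n + m = l + 1) (σ : Equiv.Perm (Fin n))
    (τ : Equiv.Perm (Fin m)) (ρ : Equiv.Perm (Fin l)) : Prop :=
  (∀ j : Fin m, ρ (inPos i h j) = inPos (σ i) h (τ j)) ∧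
  ∀ (j : Fin n) (hj : j ≠ i),
    ρ (outPos i h j hj) = outPos (σ i) h (σ j) (fun e => hj (σ.injective e))

/-! ### Operads in graded vector spaces -/

/-- A (symmetric, unital) operad in `ℤ`-graded `K`-vector spaces, in the partial composition form.
`obj n` is the space of operations of arity `n`, `gr n d` its homogeneous part of degree `d`,
`act σ x` is the right action `x · σ`: the `q`-th input of `x · σ` is the `σ q`-th input of `x`. The
partial composite `x ∘_i y` is `circ i h x y`. -/
structure GradedOperad (K : Type*) [Field K] where
  obj : ℕ → Type*
  [addCommGroup : ∀ n, AddCommGroup (obj n)]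
  [module : ∀ n, Module K (obj n)]
  gr : ∀ n, ℤ → Submodule K (obj n)
  [decomposition : ∀ n, DirectSum.Decomposition (gr n)]
  act : ∀ {n : ℕ}, Equiv.Perm (Fin n) → obj n →ₗ[K] obj n
  circ : ∀ {n m l : ℕ} (_ : Fin n) (_ : n + m = l + 1), obj n →ₗ[K] obj m →ₗ[K] obj l
  one : obj 1
  act_mem : ∀ {n : ℕ} (σ : Equiv.Perm (Fin n)) {d : ℤ} {x : obj n},
    x ∈ gr n d → act σ x ∈ gr n d
  circ_mem : ∀ {n m l : ℕ} (i : Fin n) (h : n + m = l + 1) {d e : ℤ} {x : obj n} {y : obj m},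
    x ∈ gr n d → y ∈ gr m e → circ i h x y ∈ gr l (d + e)
  one_mem : one ∈ gr 1 0
  act_one : ∀ {n : ℕ} (x : obj n), act 1 x = x
  act_mul : ∀ {n : ℕ} (σ τ : Equiv.Perm (Fin n)) (x : obj n), act (σ * τ) x = act τ (act σ x)
  one_circ : ∀ {n : ℕ} (h : 1 + n = n + 1) (x : obj n), circ 0 h one x = x
  circ_one : ∀ {n : ℕ} (i : Fin n) (h : n + 1 = n + 1) (x : obj n), circ i h x one = x
  /-- Sequential axiom. -/
  circ_seq : ∀ {n m p l l' q : ℕ} (i : Fin n) (j : Fin m) (h₁ : n + m = l + 1)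
    (h₂ : l + p = q + 1) (h₃ : m + p = l' + 1) (h₄ : n + l' = q + 1)
    (x : obj n) (y : obj m) (z : obj p),
    circ (inPos i h₁ j) h₂ (circ i h₁ x y) z = circ i h₄ x (circ j h₃ y z)
  /-- Parallel axiom, with its Koszul sign. -/
  circ_par : ∀ {n m p l l' q : ℕ} (i k : Fin n) (hik : i ≠ k) (h₁ : n + m = l + 1)
    (h₂ : l + p = q + 1) (h₃ : n + p = l' + 1) (h₄ : l' + m = q + 1) {d e : ℤ}
    (x : obj n) (y : obj m) (z : obj p), y ∈ gr m d → z ∈ gr p e →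
    circ (outPos i h₁ k hik.symm) h₂ (circ i h₁ x y) z =
      ((-1 : ℤˣ) ^ (d * e)) • circ (outPos k h₃ i hik) h₄ (circ k h₃ x z) y
  /-- Equivariance. -/
  circ_act : ∀ {n m l : ℕ} (i : Fin n) (h : n + m = l + 1) (σ : Equiv.Perm (Fin n))
    (τ : Equiv.Perm (Fin m)) (ρ : Equiv.Perm (Fin l)), IsCompositePerm i h σ τ ρ →
    ∀ (x : obj n) (y : obj m),
      circ i h (act σ x) (act τ y) = act ρ (circ (σ i) h x y)

attribute [instance] GradedOperad.addCommGroup GradedOperad.module GradedOperad.decomposition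

/-! ### Cocommutative Hopf operads -/

section Koszul

variable {K M N : Type*} [Field K] [AddCommGroup M] [Module K M] [AddCommGroup N] [Module K N]
  (𝒜 : ℤ → Submodule K M) (ℬ : ℤ → Submodule K N)

/-- The degree `f` part of the tensor product of two graded vector spaces. -/
def tensorGr (f : ℤ) : Submodule K (M ⊗[K] N) :=
  ⨆ d : ℤ, LinearMap.range (TensorProduct.map (𝒜 d).subtype (ℬ (f - d)).subtype)

variable [DirectSum.Decomposition 𝒜] [DirectSum.Decomposition ℬ]

/-- The braiding `a ⊗ b ↦ (-1)^(|a||b|) b ⊗ a` of graded vector spaces. -/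
noncomputable def koszul : M ⊗[K] N →ₗ[K] N ⊗[K] M :=
  (TensorProduct.map (DirectSum.decomposeLinearEquiv ℬ).symm.toLinearMap
      (DirectSum.decomposeLinearEquiv 𝒜).symm.toLinearMap) ∘ₗ
    (TensorProduct.gradedComm K (fun d => 𝒜 d) (fun d => ℬ d)).toLinearMap ∘ₗ
    TensorProduct.map (DirectSum.decomposeLinearEquiv 𝒜).toLinearMap
      (DirectSum.decomposeLinearEquiv ℬ).toLinearMap

theorem koszul_tmul {d e : ℤ} {a : M} {b : N} (ha : a ∈ 𝒜 d) (hb : b ∈ ℬ e) :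
    koszul 𝒜 ℬ (a ⊗ₜ[K] b) = ((-1 : ℤˣ) ^ (d * e)) • (b ⊗ₜ[K] a) := by
  have h1 : DirectSum.decomposeLinearEquiv 𝒜 a = DirectSum.lof K ℤ (fun d => 𝒜 d) d ⟨a, ha⟩ :=
    DirectSum.decompose_of_mem 𝒜 ha
  have h2 : DirectSum.decomposeLinearEquiv ℬ b = DirectSum.lof K ℤ (fun d => ℬ d) e ⟨b, hb⟩ :=
    DirectSum.decompose_of_mem ℬ hb
  have h1' := (LinearEquiv.eq_symm_apply _).2 h1
  have h2' := (LinearEquiv.eq_symm_apply _).2 h2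
  simp only [koszul, LinearMap.comp_apply, TensorProduct.map_tmul, LinearEquiv.coe_coe, h1, h2]
  rw [TensorProduct.gradedComm_of_tmul_of, Units.smul_def, map_zsmul, TensorProduct.map_tmul,
    mul_comm e d, ← Units.smul_def]
  simp only [LinearEquiv.coe_coe]
  rw [← h1', ← h2']

end Koszul

namespace GradedOperad

variable {K : Type*} [Field K] (P : GradedOperad K)

/-- The partial composition of the arity-wise tensor square of an operad:
`(a ⊗ b) ∘_i (c ⊗ d) = (-1)^(|b||c|) (a ∘_i c) ⊗ (b ∘_i d)`. -/
noncomputable def circTensor {n m l : ℕ} (i : Fin n) (h : n + m = l + 1) :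
    (P.obj n ⊗[K] P.obj n) ⊗[K] (P.obj m ⊗[K] P.obj m) →ₗ[K] P.obj l ⊗[K] P.obj l :=
  TensorProduct.map (TensorProduct.lift (P.circ i h)) (TensorProduct.lift (P.circ i h)) ∘ₗ
    (TensorProduct.assoc K (P.obj n) (P.obj m) (P.obj n ⊗[K] P.obj m)).symm.toLinearMap ∘ₗ
    TensorProduct.map LinearMap.id
      ((TensorProduct.assoc K (P.obj m) (P.obj n) (P.obj m)).toLinearMap ∘ₗ
        TensorProduct.map (koszul (P.gr n) (P.gr m)) LinearMap.id ∘ₗ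
        (TensorProduct.assoc K (P.obj n) (P.obj m) (P.obj m)).symm.toLinearMap) ∘ₗ
    (TensorProduct.assoc K (P.obj n) (P.obj n) (P.obj m ⊗[K] P.obj m)).toLinearMap

theorem circTensor_tmul {n m l : ℕ} (i : Fin n) (h : n + m = l + 1) {e f : ℤ}
    (a : P.obj n) {b : P.obj n} {c : P.obj m} (d : P.obj m)
    (hb : b ∈ P.gr n e) (hc : c ∈ P.gr m f) :
    P.circTensor i h ((a ⊗ₜ b) ⊗ₜ (c ⊗ₜ d)) =
      ((-1 : ℤˣ) ^ (e * f)) • (P.circ i h a c ⊗ₜ[K] P.circ i h b d) := by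
  simp only [circTensor, LinearMap.comp_apply, LinearEquiv.coe_coe, TensorProduct.assoc_tmul,
    TensorProduct.map_tmul, TensorProduct.assoc_symm_tmul, koszul_tmul _ _ hb hc,
    LinearMap.id_apply, Units.smul_def, ← Int.cast_smul_eq_zsmul K, TensorProduct.smul_tmul',
    TensorProduct.tmul_smul, map_smul, LinearMap.smul_apply, TensorProduct.lift.tmul]

end GradedOperad

/-- A cocommutative Hopf operad structure on a graded operad `P`: the structure of a (coassociative,
counital, graded) cocommutative coalgebra on every `P(n)`, such that the action of the symmetric
groups, the partial compositions and the unit are morphisms of coalgebras.  Equivalently, `P` is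
lifted to an operad in the symmetric monoidal category of cocommutative coalgebras. -/
structure CocommHopfStructure {K : Type*} [Field K] (P : GradedOperad K) where
  coalgebra : ∀ n, Coalgebra K (P.obj n)
  comul_mem : ∀ (n : ℕ) (d : ℤ) (x : P.obj n), x ∈ P.gr n d →
    (coalgebra n).comul x ∈ tensorGr (P.gr n) (P.gr n) d
  counit_eq_zero : ∀ (n : ℕ) (d : ℤ) (x : P.obj n), x ∈ P.gr n d → d ≠ 0 →
    (coalgebra n).counit x = 0
  cocomm : ∀ (n : ℕ) (x : P.obj n),
    koszul (P.gr n) (P.gr n) ((coalgebra n).comul x) = (coalgebra n).comul x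
  comul_act : ∀ {n : ℕ} (σ : Equiv.Perm (Fin n)) (x : P.obj n),
    (coalgebra n).comul (P.act σ x) =
      TensorProduct.map (P.act σ) (P.act σ) ((coalgebra n).comul x)
  counit_act : ∀ {n : ℕ} (σ : Equiv.Perm (Fin n)) (x : P.obj n),
    (coalgebra n).counit (P.act σ x) = (coalgebra n).counit x
  comul_circ : ∀ {n m l : ℕ} (i : Fin n) (h : n + m = l + 1) (x : P.obj n) (y : P.obj m),
    (coalgebra l).comul (P.circ i h x y) =
      P.circTensor i h ((coalgebra n).comul x ⊗ₜ (coalgebra m).comul y)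
  counit_circ : ∀ {n m l : ℕ} (i : Fin n) (h : n + m = l + 1) (x : P.obj n) (y : P.obj m),
    (coalgebra l).counit (P.circ i h x y) = (coalgebra n).counit x * (coalgebra m).counit y
  comul_one : (coalgebra 1).comul P.one = P.one ⊗ₜ P.one
  counit_one : (coalgebra 1).counit P.one = 1

/-! ### Operads presented by generators and relations -/

/-- Formal operadic terms on generators `G n` of arity `n`. -/
inductive OpTerm (G : ℕ → Type) : ℕ → Type
  | gen {n : ℕ} (g : G n) : OpTerm G n
  | one : OpTerm G 1
  | act {n : ℕ} (σ : Equiv.Perm (Fin n)) (t : OpTerm G n) : OpTerm G n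
  | circ {n m l : ℕ} (i : Fin n) (h : n + m = l + 1) (s : OpTerm G n) (t : OpTerm G m) : OpTerm G l

namespace OpTerm

variable {G : ℕ → Type}

/-- The degree of a term: the sum of the degrees of its generators. -/
def deg (γ : ∀ n, G n → ℤ) : ∀ {n : ℕ}, OpTerm G n → ℤ
  | _, gen g => γ _ g
  | _, one => 0
  | _, act _ t => deg γ t
  | _, circ _ _ s t => deg γ s + deg γ t

/-- Formal linear combinations of terms of arity `n`. -/
abbrev Comb (K : Type*) [Field K] (G : ℕ → Type) (n : ℕ) : Type _ := OpTerm G n →₀ K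

/-- The combinations of terms of degree `d`. -/
def homog (K : Type*) [Field K] (γ : ∀ n, G n → ℤ) (n : ℕ) (d : ℤ) : Submodule K (Comb K G n) :=
  Finsupp.supported K K {t : OpTerm G n | deg γ t = d}

variable (K : Type*) [Field K]

/-- A term, as a linear combination. -/
noncomputable def single {n : ℕ} (t : OpTerm G n) : Comb K G n := Finsupp.single t 1

variable {K}

/-- The linear extension of `OpTerm.act`. -/
noncomputable def actC {n : ℕ} (σ : Equiv.Perm (Fin n)) : Comb K G n →ₗ[K] Comb K G n :=
  Finsupp.lmapDomain K K (act σ)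

/-- The bilinear extension of `OpTerm.circ`. -/
noncomputable def circC {n m l : ℕ} (i : Fin n) (h : n + m = l + 1) :
    Comb K G n →ₗ[K] Comb K G m →ₗ[K] Comb K G l :=
  Finsupp.linearCombination K (fun s => Finsupp.lmapDomain K K (circ i h s))

@[simp] theorem actC_single {n : ℕ} (σ : Equiv.Perm (Fin n)) (t : OpTerm G n) :
    actC σ (single K t) = single K (act σ t) := by
  simp [actC, single, Finsupp.mapDomain_single]

@[simp] theorem circC_single {n m l : ℕ} (i : Fin n) (h : n + m = l + 1) (s : OpTerm G n)
    (t : OpTerm G m) : circC i h (single K s) (single K t) = single K (circ i h s t) := by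
  simp [circC, single, Finsupp.mapDomain_single]

theorem comb_ext {M : Type*} [AddCommGroup M] [Module K M] {n : ℕ} {f g : Comb K G n →ₗ[K] M}
    (h : ∀ t, f (single K t) = g (single K t)) : f = g :=
  Finsupp.lhom_ext' fun t => LinearMap.ext_ring (h t)

variable {γ : ∀ n, G n → ℤ}

theorem single_mem {n : ℕ} (t : OpTerm G n) : single K t ∈ homog K γ n (deg γ t) :=
  Finsupp.single_mem_supported K _ rfl

theorem homog_eq_span (n : ℕ) (d : ℤ) :
    homog K γ n d = Submodule.span K (single K '' {t : OpTerm G n | deg γ t = d}) :=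
  Finsupp.supported_eq_span_single K _

theorem actC_mem {n : ℕ} (σ : Equiv.Perm (Fin n)) {d : ℤ} {x : Comb K G n}
    (hx : x ∈ homog K γ n d) : actC σ x ∈ homog K γ n d := by
  rw [homog_eq_span] at hx
  induction hx using Submodule.span_induction with
  | mem x hx =>
    obtain ⟨t, rfl, rfl⟩ := hx
    rw [actC_single]
    exact single_mem (act σ t)
  | zero => simp
  | add x y _ _ hx hy => rw [map_add]; exact add_mem hx hy
  | smul c x _ hx => rw [map_smul]; exact Submodule.smul_mem _ _ hx

theorem circC_mem {n m l : ℕ} (i : Fin n) (h : n + m = l + 1) {d e : ℤ} {x : Comb K G n}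
    {y : Comb K G m} (hx : x ∈ homog K γ n d) (hy : y ∈ homog K γ m e) :
    circC i h x y ∈ homog K γ l (d + e) := by
  rw [homog_eq_span] at hx hy
  induction hx using Submodule.span_induction with
  | mem x hx =>
    obtain ⟨s, rfl, rfl⟩ := hx
    induction hy using Submodule.span_induction with
    | mem y hy =>
      obtain ⟨t, rfl, rfl⟩ := hy
      rw [circC_single]
      exact single_mem (circ i h s t)
    | zero => simp
    | add x y _ _ hx hy => rw [map_add]; exact add_mem hx hy
    | smul c x _ hx => rw [map_smul]; exact Submodule.smul_mem _ _ hx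
  | zero => simp
  | add x y _ _ hx hy => rw [map_add, LinearMap.add_apply]; exact add_mem hx hy
  | smul c x _ hx => rw [map_smul, LinearMap.smul_apply]; exact Submodule.smul_mem _ _ hx

end OpTerm

/-- A presentation of a graded operad: generators `gen n` of arity `n`, with their degrees, and
homogeneous relations `rel n x`, which stand for `x = 0`. -/
structure OperadPresentation (K : Type*) [Field K] where
  gen : ℕ → Type
  deg : ∀ n, gen n → ℤ
  rel : ∀ n, OpTerm.Comb K gen n → Prop
  rel_homog : ∀ n x, rel n x → ∃ d, x ∈ OpTerm.homog K deg n d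

namespace OperadPresentation

open OpTerm

variable {K : Type*} [Field K] (Q : OperadPresentation K)

/-- The generating relations of the presented operad: the axioms of an operad, the relations of the
presentation, and everything obtained from them by the symmetric groups and by composition. -/
inductive Rel : ∀ n : ℕ, Comb K Q.gen n → Prop
  | of_rel {n : ℕ} (x : Comb K Q.gen n) : Q.rel n x → Rel n x
  | act_one {n : ℕ} (t : OpTerm Q.gen n) : Rel n (single K (act 1 t) - single K t)
  | act_mul {n : ℕ} (σ τ : Equiv.Perm (Fin n)) (t : OpTerm Q.gen n) :
      Rel n (single K (act (σ * τ) t) - single K (act τ (act σ t)))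
  | one_circ {n : ℕ} (h : 1 + n = n + 1) (t : OpTerm Q.gen n) :
      Rel n (single K (circ 0 h one t) - single K t)
  | circ_one {n : ℕ} (i : Fin n) (h : n + 1 = n + 1) (t : OpTerm Q.gen n) :
      Rel n (single K (circ i h t one) - single K t)
  | circ_seq {n m p l l' q : ℕ} (i : Fin n) (j : Fin m) (h₁ : n + m = l + 1)
      (h₂ : l + p = q + 1) (h₃ : m + p = l' + 1) (h₄ : n + l' = q + 1)
      (x : OpTerm Q.gen n) (y : OpTerm Q.gen m) (z : OpTerm Q.gen p) :
      Rel q (single K (circ (inPos i h₁ j) h₂ (circ i h₁ x y) z) -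
        single K (circ i h₄ x (circ j h₃ y z)))
  | circ_par {n m p l l' q : ℕ} (i k : Fin n) (hik : i ≠ k) (h₁ : n + m = l + 1)
      (h₂ : l + p = q + 1) (h₃ : n + p = l' + 1) (h₄ : l' + m = q + 1)
      (x : OpTerm Q.gen n) (y : OpTerm Q.gen m) (z : OpTerm Q.gen p) :
      Rel q (single K (circ (outPos i h₁ k hik.symm) h₂ (circ i h₁ x y) z) -
        ((-1 : ℤˣ) ^ (OpTerm.deg Q.deg y * OpTerm.deg Q.deg z)) •
          single K (circ (outPos k h₃ i hik) h₄ (circ k h₃ x z) y))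
  | circ_act {n m l : ℕ} (i : Fin n) (h : n + m = l + 1) (σ : Equiv.Perm (Fin n))
      (τ : Equiv.Perm (Fin m)) (ρ : Equiv.Perm (Fin l)) (hρ : IsCompositePerm i h σ τ ρ)
      (x : OpTerm Q.gen n) (y : OpTerm Q.gen m) :
      Rel l (single K (circ i h (act σ x) (act τ y)) - single K (act ρ (circ (σ i) h x y)))
  | act {n : ℕ} (σ : Equiv.Perm (Fin n)) (x : Comb K Q.gen n) : Rel n x → Rel n (actC σ x)
  | circ_left {n m l : ℕ} (i : Fin n) (h : n + m = l + 1) (x : Comb K Q.gen n)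
      (t : OpTerm Q.gen m) : Rel n x → Rel l (circC i h x (single K t))
  | circ_right {n m l : ℕ} (i : Fin n) (h : n + m = l + 1) (s : OpTerm Q.gen n)
      (y : Comb K Q.gen m) : Rel m y → Rel l (circC i h (single K s) y)

/-- The subspace spanned by all relations in arity `n`. -/
noncomputable def relSpan (n : ℕ) : Submodule K (Comb K Q.gen n) := Submodule.span K {x | Q.Rel n x}

/-- The arity `n` component of the presented operad. -/
def Obj (n : ℕ) : Type _ := Comb K Q.gen n ⧸ Q.relSpan n

noncomputable instance (n : ℕ) : AddCommGroup (Q.Obj n) :=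
  inferInstanceAs (AddCommGroup (Comb K Q.gen n ⧸ Q.relSpan n))

noncomputable instance (n : ℕ) : Module K (Q.Obj n) :=
  inferInstanceAs (Module K (Comb K Q.gen n ⧸ Q.relSpan n))

/-- The class of a combination of terms. -/
noncomputable def cls (n : ℕ) : Comb K Q.gen n →ₗ[K] Q.Obj n := (Q.relSpan n).mkQ

/-- The degree `d` part of the arity `n` component: the classes of combinations of terms of
degree `d`. -/
noncomputable def grading (n : ℕ) (d : ℤ) : Submodule K (Q.Obj n) :=
  (homog K Q.deg n d).map (Q.cls n)

variable {Q}

theorem sub_mem_homog {n : ℕ} {s t : OpTerm Q.gen n}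
    (h : OpTerm.deg Q.deg s = OpTerm.deg Q.deg t) :
    ∃ d, single K s - single K t ∈ homog K Q.deg n d :=
  ⟨OpTerm.deg Q.deg s, sub_mem (single_mem s) (h ▸ single_mem t)⟩

theorem Rel.homog {n : ℕ} {x : Comb K Q.gen n} (hx : Q.Rel n x) :
    ∃ d, x ∈ homog K Q.deg n d := by
  induction hx with
  | of_rel x hx => exact Q.rel_homog _ x hx
  | act_one t => exact sub_mem_homog (by simp [OpTerm.deg])
  | act_mul σ τ t => exact sub_mem_homog (by simp [OpTerm.deg])
  | one_circ h t => exact sub_mem_homog (by simp [OpTerm.deg])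
  | circ_one i h t => exact sub_mem_homog (by simp [OpTerm.deg])
  | circ_seq i j h₁ h₂ h₃ h₄ x y z => exact sub_mem_homog (by simp [OpTerm.deg, add_assoc])
  | circ_par i k hik h₁ h₂ h₃ h₄ x y z =>
    refine ⟨OpTerm.deg Q.deg x + OpTerm.deg Q.deg y + OpTerm.deg Q.deg z,
      sub_mem (single_mem _) ?_⟩
    rw [Units.smul_def]
    refine zsmul_mem ?_ _
    rw [add_right_comm]
    exact single_mem _
  | circ_act i h σ τ ρ hρ x y => exact sub_mem_homog (by simp [OpTerm.deg])
  | act σ x _ ih => exact ⟨ih.choose, actC_mem σ ih.choose_spec⟩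
  | circ_left i h x t _ ih => exact ⟨_, circC_mem i h ih.choose_spec (single_mem t)⟩
  | circ_right i h s y _ ih => exact ⟨_, circC_mem i h (single_mem s) ih.choose_spec⟩

theorem cls_mem {n : ℕ} {d : ℤ} {x : Comb K Q.gen n} (hx : x ∈ OpTerm.homog K Q.deg n d) :
    Q.cls n x ∈ Q.grading n d :=
  Submodule.mem_map_of_mem hx

variable (Q)

/-- The decomposition of linear combinations of terms into homogeneous components. -/
noncomputable def preDecompose (n : ℕ) : Comb K Q.gen n →ₗ[K] ⨁ d, Q.grading n d :=
  Finsupp.linearCombination K (fun t =>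
    DirectSum.lof K ℤ (fun d => Q.grading n d) (OpTerm.deg Q.deg t)
      ⟨Q.cls n (single K t), cls_mem (single_mem t)⟩)

variable {Q}

theorem preDecompose_of_mem {n : ℕ} {d : ℤ} {x : Comb K Q.gen n}
    (hx : x ∈ OpTerm.homog K Q.deg n d) :
    Q.preDecompose n x = DirectSum.lof K ℤ (fun d => Q.grading n d) d
      ⟨Q.cls n x, cls_mem hx⟩ := by
  suffices H : ∃ h : Q.cls n x ∈ Q.grading n d,
      Q.preDecompose n x = DirectSum.lof K ℤ (fun d => Q.grading n d) d ⟨_, h⟩ from H.choose_spec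
  rw [homog_eq_span] at hx
  induction hx using Submodule.span_induction with
  | mem x hx =>
    obtain ⟨t, rfl, rfl⟩ := hx
    exact ⟨cls_mem (single_mem t), by simp [preDecompose, single]⟩
  | zero =>
    exact ⟨by simp, by
      rw [map_zero, eq_comm]
      exact map_zero (DirectSum.lof K ℤ (fun d => Q.grading n d) d)⟩
  | add x y _ _ ihx ihy =>
    obtain ⟨hx, ihx⟩ := ihx
    obtain ⟨hy, ihy⟩ := ihy
    refine ⟨by rw [map_add]; exact add_mem hx hy, ?_⟩
    rw [map_add, ihx, ihy, ← map_add]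
    rfl
  | smul c x _ ih =>
    obtain ⟨hx, ih⟩ := ih
    refine ⟨by rw [map_smul]; exact Submodule.smul_mem _ _ hx, ?_⟩
    rw [map_smul, ih, ← map_smul]
    rfl

theorem relSpan_le_ker (n : ℕ) : Q.relSpan n ≤ LinearMap.ker (Q.preDecompose n) := by
  refine Submodule.span_le.2 fun x hx => ?_
  obtain ⟨d, hd⟩ := Rel.homog hx
  have h0 : Q.cls n x = 0 :=
    (Submodule.Quotient.mk_eq_zero _).2 (Submodule.subset_span hx)
  rw [SetLike.mem_coe, LinearMap.mem_ker, preDecompose_of_mem hd]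
  have h1 : (⟨Q.cls n x, cls_mem hd⟩ : Q.grading n d) = 0 := Subtype.ext h0
  rw [h1, map_zero]

variable (Q)

/-- The decomposition of the presented operad into homogeneous components. -/
noncomputable def decomposeMap (n : ℕ) : Q.Obj n →ₗ[K] ⨁ d, Q.grading n d :=
  (Q.relSpan n).liftQ (Q.preDecompose n) (relSpan_le_ker n)

theorem decomposeMap_cls (n : ℕ) (x : Comb K Q.gen n) :
    Q.decomposeMap n (Q.cls n x) = Q.preDecompose n x := rfl

theorem cls_surjective (n : ℕ) : Function.Surjective (Q.cls n) := (Q.relSpan n).mkQ_surjective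

theorem obj_ext {n : ℕ} {M : Type*} [AddCommGroup M] [Module K M] {f g : Q.Obj n →ₗ[K] M}
    (h : ∀ t, f (Q.cls n (single K t)) = g (Q.cls n (single K t))) : f = g :=
  (LinearMap.cancel_right (Q.cls_surjective n)).1 (comb_ext h)

theorem decompose_left (n : ℕ) :
    DirectSum.coeLinearMap (Q.grading n) ∘ₗ Q.decomposeMap n = .id := by
  refine Q.obj_ext fun t => ?_
  rw [LinearMap.comp_apply, decomposeMap_cls, preDecompose_of_mem (single_mem t),
    DirectSum.coeLinearMap_lof]
  rfl

theorem decompose_right (n : ℕ) :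
    Q.decomposeMap n ∘ₗ DirectSum.coeLinearMap (Q.grading n) = .id := by
  refine DirectSum.linearMap_ext K fun d => LinearMap.ext fun x => ?_
  obtain ⟨x, y, hy, rfl⟩ := x
  rw [LinearMap.comp_apply, LinearMap.comp_apply, DirectSum.coeLinearMap_lof,
    decomposeMap_cls, preDecompose_of_mem hy]
  rfl

/-- The presented operad is graded. -/
noncomputable instance gradingDecomposition (n : ℕ) : DirectSum.Decomposition (Q.grading n) :=
  DirectSum.Decomposition.ofLinearMap (Q.grading n) (Q.decomposeMap n) (Q.decompose_left n)
    (Q.decompose_right n)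

/-- The right action of the symmetric groups on the presented operad. -/
noncomputable def objAct {n : ℕ} (σ : Equiv.Perm (Fin n)) : Q.Obj n →ₗ[K] Q.Obj n :=
  (Q.relSpan n).mapQ (Q.relSpan n) (actC σ) (Submodule.span_le.2 fun x hx =>
    Submodule.subset_span (Rel.act σ x hx))

theorem circC_left_mem {n m l : ℕ} (i : Fin n) (h : n + m = l + 1) {x : Comb K Q.gen n}
    (hx : x ∈ Q.relSpan n) (y : Comb K Q.gen m) : circC i h x y ∈ Q.relSpan l := by
  induction hx using Submodule.span_induction with
  | mem x hx =>
    induction y using Finsupp.induction_linear with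
    | zero => simp
    | add y z hy hz => rw [map_add]; exact add_mem hy hz
    | single t c =>
      rw [← mul_one c, ← smul_eq_mul, ← Finsupp.smul_single, map_smul]
      exact Submodule.smul_mem _ _ (Submodule.subset_span (Rel.circ_left i h x t hx))
  | zero => simp
  | add x y _ _ hx hy => rw [map_add, LinearMap.add_apply]; exact add_mem hx hy
  | smul c x _ hx => rw [map_smul, LinearMap.smul_apply]; exact Submodule.smul_mem _ _ hx

theorem circC_right_mem {n m l : ℕ} (i : Fin n) (h : n + m = l + 1) (x : Comb K Q.gen n)
    {y : Comb K Q.gen m} (hy : y ∈ Q.relSpan m) : circC i h x y ∈ Q.relSpan l := by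
  induction hy using Submodule.span_induction with
  | mem y hy =>
    induction x using Finsupp.induction_linear with
    | zero => simp
    | add x z hx hz => rw [map_add, LinearMap.add_apply]; exact add_mem hx hz
    | single t c =>
      rw [← mul_one c, ← smul_eq_mul, ← Finsupp.smul_single, map_smul, LinearMap.smul_apply]
      exact Submodule.smul_mem _ _ (Submodule.subset_span (Rel.circ_right i h t y hy))
  | zero => simp
  | add x y _ _ hx hy => rw [map_add]; exact add_mem hx hy
  | smul c x _ hx => rw [map_smul]; exact Submodule.smul_mem _ _ hx

/-- The partial compositions of the presented operad. -/
noncomputable def objCirc {n m l : ℕ} (i : Fin n) (h : n + m = l + 1) :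
    Q.Obj n →ₗ[K] Q.Obj m →ₗ[K] Q.Obj l :=
  LinearMap.liftQ₂ (Q.relSpan n) (Q.relSpan m) ((circC i h).compr₂ (Q.cls l))
    (fun x hx => by
      rw [LinearMap.mem_ker]
      exact LinearMap.ext fun y =>
        (Submodule.Quotient.mk_eq_zero _).2 (Q.circC_left_mem i h hx y))
    (fun y hy => by
      rw [LinearMap.mem_ker]
      exact LinearMap.ext fun x =>
        (Submodule.Quotient.mk_eq_zero _).2 (Q.circC_right_mem i h x hy))

variable {Q}

theorem objCirc_cls {n m l : ℕ} (i : Fin n) (h : n + m = l + 1) (x : Comb K Q.gen n)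
    (y : Comb K Q.gen m) : Q.objCirc i h (Q.cls n x) (Q.cls m y) =
      Q.cls l (circC i h x y) := rfl

theorem objAct_cls {n : ℕ} (σ : Equiv.Perm (Fin n)) (x : Comb K Q.gen n) :
    Q.objAct σ (Q.cls n x) = Q.cls n (actC σ x) := rfl

@[elab_as_elim]
theorem obj_induction {n : ℕ} {p : Q.Obj n → Prop} (x : Q.Obj n) (zero : p 0)
    (add : ∀ x y, p x → p y → p (x + y)) (smul : ∀ (c : K) x, p x → p (c • x))
    (single : ∀ t, p (Q.cls n (single K t))) : p x := by
  obtain ⟨x, rfl⟩ := Q.cls_surjective n x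
  induction x using Finsupp.induction_linear with
  | zero => rwa [map_zero]
  | add x y hx hy => rw [map_add]; exact add _ _ hx hy
  | single t c =>
    rw [← mul_one c, ← smul_eq_mul, ← Finsupp.smul_single, map_smul]
    exact smul c _ (single t)

@[elab_as_elim]
theorem grading_induction {n : ℕ} {d : ℤ} {p : Q.Obj n → Prop} (x : Q.Obj n)
    (hx : x ∈ Q.grading n d) (zero : p 0)
    (add : ∀ x y, p x → p y → p (x + y)) (smul : ∀ (c : K) x, p x → p (c • x))
    (single : ∀ t, OpTerm.deg Q.deg t = d → p (Q.cls n (single K t))) : p x := by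
  obtain ⟨x, hx, rfl⟩ := hx
  rw [SetLike.mem_coe, homog_eq_span] at hx
  induction hx using Submodule.span_induction with
  | mem x hx =>
    obtain ⟨t, ht, rfl⟩ := hx
    exact single t ht
  | zero => rwa [map_zero]
  | add x y _ _ hx hy => rw [map_add]; exact add _ _ hx hy
  | smul c x _ hx => rw [map_smul]; exact smul c _ hx

theorem cls_eq_cls {n : ℕ} {x y : Comb K Q.gen n} (h : Q.Rel n (x - y)) :
    Q.cls n x = Q.cls n y :=
  (Submodule.Quotient.eq _).2 (Submodule.subset_span h)

variable (Q)

/-- The graded operad presented by the given generators and relations: the quotient of the free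
operad on the generators by the operadic ideal generated by the relations. -/
noncomputable def operad : GradedOperad K where
  obj := Q.Obj
  gr := Q.grading
  decomposition := Q.gradingDecomposition
  act := Q.objAct
  circ := Q.objCirc
  one := Q.cls 1 (single K one)
  act_mem := by
    rintro n σ d _ ⟨x, hx, rfl⟩
    exact cls_mem (actC_mem σ hx)
  circ_mem := by
    rintro n m l i h d e _ _ ⟨x, hx, rfl⟩ ⟨y, hy, rfl⟩
    exact cls_mem (circC_mem i h hx hy)
  one_mem := cls_mem (single_mem _)
  act_one := by
    intro n x
    refine obj_induction (p := fun x => Q.objAct 1 x = x) x (by simp)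
      (fun x y hx hy => by rw [map_add, hx, hy])
      (fun c x hx => by rw [map_smul, hx]) fun t => ?_
    rw [objAct_cls, actC_single]
    exact cls_eq_cls (Rel.act_one t)
  act_mul := by
    intro n σ τ x
    refine obj_induction (p := fun x => Q.objAct (σ * τ) x = Q.objAct τ (Q.objAct σ x)) x (by simp)
      (fun x y hx hy => by simp only [map_add, hx, hy])
      (fun c x hx => by simp only [map_smul, hx]) fun t => ?_
    simp only [objAct_cls, actC_single]
    exact cls_eq_cls (Rel.act_mul σ τ t)
  one_circ := by
    intro n h x
    refine obj_induction (p := fun x => Q.objCirc 0 h (Q.cls 1 (single K one)) x = x) x (by simp)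
      (fun x y hx hy => by rw [map_add, hx, hy])
      (fun c x hx => by rw [map_smul, hx]) fun t => ?_
    rw [objCirc_cls, circC_single]
    exact cls_eq_cls (Rel.one_circ h t)
  circ_one := by
    intro n i h x
    refine obj_induction (p := fun x => Q.objCirc i h x (Q.cls 1 (single K one)) = x) x (by simp)
      (fun x y hx hy => by rw [map_add, LinearMap.add_apply, hx, hy])
      (fun c x hx => by rw [map_smul, LinearMap.smul_apply, hx]) fun t => ?_
    rw [objCirc_cls, circC_single]
    exact cls_eq_cls (Rel.circ_one i h t)
  circ_seq := by
    intro n m p l l' q i j h₁ h₂ h₃ h₄ x y z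
    induction x using obj_induction with
    | zero => simp
    | add a b ha hb => simp only [map_add, LinearMap.add_apply, ha, hb]
    | smul c a ha => simp only [map_smul, LinearMap.smul_apply, ha]
    | single x =>
    induction y using obj_induction with
    | zero => simp
    | add a b ha hb => simp only [map_add, LinearMap.add_apply, ha, hb]
    | smul c a ha => simp only [map_smul, LinearMap.smul_apply, ha]
    | single y =>
    induction z using obj_induction with
    | zero => simp
    | add a b ha hb => simp only [map_add, ha, hb]
    | smul c a ha => simp only [map_smul, ha]
    | single z =>
    simp only [objCirc_cls, circC_single]
    exact cls_eq_cls (Rel.circ_seq i j h₁ h₂ h₃ h₄ x y z)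
  circ_par := by
    intro n m p l l' q i k hik h₁ h₂ h₃ h₄ d e x y z hy hz
    rw [Units.smul_def, ← Int.cast_smul_eq_zsmul K]
    induction x using obj_induction with
    | zero => simp
    | add a b ha hb => simp only [map_add, LinearMap.add_apply, smul_add, ha, hb]
    | smul c a ha =>
      simp only [map_smul, LinearMap.smul_apply, ha]
      rw [smul_comm]
    | single x =>
    refine grading_induction y hy (by simp)
      (fun a b ha hb => by simp only [map_add, LinearMap.add_apply, smul_add, ha, hb])
      (fun c a ha => by
        simp only [map_smul, LinearMap.smul_apply, ha]
        rw [smul_comm]) fun y hy => ?_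
    refine grading_induction z hz (by simp)
      (fun a b ha hb => by simp only [map_add, LinearMap.add_apply, smul_add, ha, hb])
      (fun c a ha => by
        simp only [map_smul, LinearMap.smul_apply, ha]
        rw [smul_comm]) fun z hz => ?_
    simp only [objCirc_cls, circC_single]
    rw [← map_smul, Int.cast_smul_eq_zsmul K, ← Units.smul_def]
    subst hy hz
    exact cls_eq_cls (Rel.circ_par i k hik h₁ h₂ h₃ h₄ x y z)
  circ_act := by
    intro n m l i h σ τ ρ hρ x y
    induction x using obj_induction with
    | zero => simp
    | add a b ha hb => simp only [map_add, LinearMap.add_apply, ha, hb]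
    | smul c a ha => simp only [map_smul, LinearMap.smul_apply, ha]
    | single x =>
    induction y using obj_induction with
    | zero => simp
    | add a b ha hb => simp only [map_add, ha, hb]
    | smul c a ha => simp only [map_smul, ha]
    | single y =>
    simp only [objCirc_cls, objAct_cls, circC_single, actC_single]
    exact cls_eq_cls (Rel.circ_act i h σ τ ρ hρ x y)

/-- The element of the presented operad given by a generator. -/
noncomputable def ofGen {n : ℕ} (g : Q.gen n) : Q.operad.obj n :=
  Q.cls n (single K (OpTerm.gen g))

end OperadPresentation

/-! ### Unital `r`-Gerstenhaber algebras -/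

/-- The generators of the operad of unital `r`-Gerstenhaber algebras: the unit `u`, the product `μ`
of arity `2` and the bracket `β` of arity `r + 1`. -/
inductive UGerstGen (r : ℕ) : ℕ → Type
  | u : UGerstGen r 0
  | mu : UGerstGen r 2
  | beta : UGerstGen r (r + 1)

namespace UGerst

open OpTerm

/-- `u` and `μ` have degree `0`, and `β` has degree `1`. -/
def deg (r : ℕ) : ∀ n, UGerstGen r n → ℤ
  | _, .u => 0
  | _, .mu => 0
  | _, .beta => 1

variable (K : Type*) [Field K] (r : ℕ)

/-- The unit, in the free operad. -/
noncomputable def u : Comb K (UGerstGen r) 0 := single K (gen .u)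

/-- The product, in the free operad. -/
noncomputable def mu : Comb K (UGerstGen r) 2 := single K (gen .mu)

/-- The bracket, in the free operad. -/
noncomputable def beta : Comb K (UGerstGen r) (r + 1) := single K (gen .beta)

/-- The permutations `σ` of the `2r + 1` inputs such that `σ⁻¹` is increasing on the first `r + 1` and
on the last `r` elements, i.e. the inverses of the `(r + 1, r)`-shuffles. -/
def unshuffles : Finset (Equiv.Perm (Fin (2 * r + 1))) :=
  Finset.univ.filter fun σ => ∀ a b : Fin (2 * r + 1), a < b → (b.1 ≤ r ∨ r < a.1) → σ⁻¹ a < σ⁻¹ b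

/-- The relations of unital `r`-Gerstenhaber algebras. With the convention
`(x · σ)(a_1, …, a_n) = x(a_{σ⁻¹(1)}, …, a_{σ⁻¹(n)})` (no Koszul signs written), the Leibniz relation is
`β(μ(a_1, a_2), a_3, …, a_{r+2}) = μ(β(a_1, a_3, …, a_{r+2}), a_2) + μ(a_1, β(a_2, …, a_{r+2}))`, whence
the inverse of the cycle `(2 3 ⋯ r+2)` (here `1, …, r+1` as inputs are numbered from `0`). -/
inductive IsRel : ∀ n, Comb K (UGerstGen r) n → Prop
  | mu_symm (σ : Equiv.Perm (Fin 2)) : IsRel 2 (actC σ (mu K r) - mu K r)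
  | beta_symm (σ : Equiv.Perm (Fin (r + 1))) : IsRel (r + 1) (actC σ (beta K r) - beta K r)
  | unit_mu : IsRel 1 (circC 0 (by omega) (mu K r) (u K r) - single K one)
  | unit_beta : IsRel r (circC 0 (by omega) (beta K r) (u K r))
  | assoc : IsRel 3 (circC 0 (by omega) (mu K r) (mu K r) - circC 1 (by omega) (mu K r) (mu K r))
  | leibniz : IsRel (r + 2) (circC 0 (by omega) (beta K r) (mu K r) -
      (actC (Fin.cycleIcc 1 (Fin.last (r + 1)))⁻¹ (circC 0 (by omega) (mu K r) (beta K r)) +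
        circC 1 (by omega) (mu K r) (beta K r)))
  | jacobi : IsRel (2 * r + 1)
      (∑ σ ∈ unshuffles r, actC σ (circC 0 (by omega) (beta K r) (beta K r)))

variable {K r}

theorem u_mem : u K r ∈ homog K (deg r) 0 0 := single_mem _
theorem mu_mem : mu K r ∈ homog K (deg r) 2 0 := single_mem _
theorem beta_mem : beta K r ∈ homog K (deg r) (r + 1) 1 := single_mem _

theorem isRel_homog (n : ℕ) (x : Comb K (UGerstGen r) n) (hx : IsRel K r n x) :
    ∃ d, x ∈ homog K (deg r) n d := by
  cases hx with
  | mu_symm σ => exact ⟨0, sub_mem (actC_mem σ mu_mem) mu_mem⟩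
  | beta_symm σ => exact ⟨1, sub_mem (actC_mem σ beta_mem) beta_mem⟩
  | unit_mu => exact ⟨0, sub_mem (circC_mem _ _ mu_mem u_mem) (single_mem _)⟩
  | unit_beta => exact ⟨1 + 0, circC_mem _ _ beta_mem u_mem⟩
  | assoc => exact ⟨0 + 0, sub_mem (circC_mem _ _ mu_mem mu_mem) (circC_mem _ _ mu_mem mu_mem)⟩
  | leibniz => exact ⟨1, sub_mem (circC_mem _ _ beta_mem mu_mem) (add_mem
      (actC_mem _ (circC_mem _ _ mu_mem beta_mem)) (circC_mem _ _ mu_mem beta_mem))⟩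
  | jacobi => exact ⟨1 + 1, sum_mem fun σ _ => actC_mem σ (circC_mem _ _ beta_mem beta_mem)⟩

variable (K r)

/-- The presentation of the operad of unital `r`-Gerstenhaber algebras. -/
noncomputable def presentation : OperadPresentation K where
  gen := UGerstGen r
  deg := deg r
  rel := IsRel K r
  rel_homog := isRel_homog

end UGerst

/-- The operad of unital `r`-Gerstenhaber algebras. -/
noncomputable def uGerst (K : Type*) [Field K] (r : ℕ) : GradedOperad K :=
  (UGerst.presentation K r).operad

namespace uGerst

variable (K : Type*) [Field K] (r : ℕ)

/-- The unit `u`. -/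
noncomputable def u : (uGerst K r).obj 0 := (UGerst.presentation K r).ofGen UGerstGen.u

/-- The commutative product `μ`. -/
noncomputable def mu : (uGerst K r).obj 2 := (UGerst.presentation K r).ofGen UGerstGen.mu

/-- The bracket `β`. -/
noncomputable def beta : (uGerst K r).obj (r + 1) :=
  (UGerst.presentation K r).ofGen UGerstGen.beta

/-- The iterated product `μ^p = μ ∘_1 μ ∘_1 ⋯ ∘_1 μ` (`p` factors), of arity `p + 1`. -/
noncomputable def muPow : ∀ p : ℕ, (uGerst K r).obj (p + 1)
  | 0 => (uGerst K r).one
  | p + 1 => (uGerst K r).circ 0 (by omega) (muPow p) (mu K r)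

end uGerst

/-! Write `r = k - 1` and `P = uGerst K r`. The coproducts of a Hopf structure form a morphism of
operads from `P` to the arity-wise tensor square `hadamard P P`, and the counits form a morphism
from `P` to `uCom K`. A morphism out of a presented operad is the same as values of the generators
that satisfy the relations (`lift`, `hom_ext`). This gives uniqueness: the coproduct is fixed by its
values on `u`, `μ`, `β`, and the counit of a coalgebra is fixed by its coproduct. It also reduces
existence to two checks on generators: the prescribed values satisfy the relations (`eval_comulGen`,
`eval_counitGen`), and coassociativity, counitality and cocommutativity, being equalities of operad
morphisms, hold on `u`, `μ`, `β`.

The only relation of substance is Jacobi. The composite `Δβ ∘ Δβ` has four terms. Two of them are `β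
∘ β` tensored with `μ^r ∘ μ^r = μ^(2r)`; as `μ^(2r)` is symmetric, they vanish after summation by
the Jacobi relation of `P`. The mixed terms are `(β ∘ μ^r) ⊗ (μ^r ∘ β)` and, with a minus sign
because two copies of `β` pass each other, `(μ^r ∘ β) ⊗ (β ∘ μ^r)`.

For a set `T` of `r + 1` among the `2r + 1` inputs let `B_T` be the bracket of the inputs in `T`
multiplied by all the others (`bracketOf`). Summing over unshuffles amounts to summing over `T`. The
factor `μ^r ∘ β` becomes `B_T`. By the iterated Leibniz rule (`beta_circ_muPow`), `β ∘ μ^r` becomes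
the sum of `B_T'` with `T' = {j} ∪ Tᶜ`, `j ∈ T`. These `T'` are exactly the sets of `r + 1` inputs
with `T ∪ T'` everything, a condition symmetric in `T` and `T'`. Hence the two mixed sums agree and
cancel (`sum_unshuffles_mixed`). -/

/-! ### Koszul signs as scalars -/

section Sign

variable (K : Type*) [Field K]

/-- The sign `(-1)^d`, as a scalar. -/
def koszulSign (d : ℤ) : K := (((-1 : ℤˣ) ^ d : ℤˣ) : ℤ)

variable {K}

theorem negOne_pow_smul {M : Type*} [AddCommGroup M] [Module K M] (d : ℤ) (x : M) :
    ((-1 : ℤˣ) ^ d) • x = koszulSign K d • x := by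
  rw [Units.smul_def, koszulSign, Int.cast_smul_eq_zsmul]

theorem koszulSign_add (d e : ℤ) : koszulSign K (d + e) = koszulSign K d * koszulSign K e := by
  simp [koszulSign, zpow_add]

theorem koszulSign_of_even {d : ℤ} (h : Even d) : koszulSign K d = 1 := by
  simp [koszulSign, h.neg_one_zpow]

/-- Only the parity of the exponent matters, so comparing two signs amounts to exhibiting half of
the difference of their exponents. -/
theorem koszulSign_congr {d e : ℤ} (h : Even (d - e)) : koszulSign K d = koszulSign K e := by
  rw [← sub_add_cancel d e, koszulSign_add, koszulSign_of_even h, one_mul]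

@[simp] theorem koszulSign_zero : koszulSign K 0 = 1 := koszulSign_of_even (by simp)

@[simp] theorem koszulSign_one : koszulSign K 1 = -1 := by simp [koszulSign]

end Sign

/-! ### The total grading of a tensor product -/

section TensorGrading

variable {K M N : Type*} [Field K] [AddCommGroup M] [Module K M] [AddCommGroup N] [Module K N]
  {𝒜 : ℤ → Submodule K M} {ℬ : ℤ → Submodule K N}

theorem tmul_mem_tensorGr {d e f : ℤ} (h : d + e = f) {a : M} {b : N} (ha : a ∈ 𝒜 d)
    (hb : b ∈ ℬ e) : a ⊗ₜ[K] b ∈ tensorGr 𝒜 ℬ f := by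
  obtain rfl : e = f - d := by omega
  exact Submodule.mem_iSup_of_mem d ⟨⟨a, ha⟩ ⊗ₜ ⟨b, hb⟩, rfl⟩

@[elab_as_elim]
theorem tensorGr_induction {f : ℤ} {p : ∀ X : M ⊗[K] N, X ∈ tensorGr 𝒜 ℬ f → Prop}
    (zero : p 0 (zero_mem _))
    (add : ∀ x y hx hy, p x hx → p y hy → p (x + y) (add_mem hx hy))
    (tmul : ∀ d e (h : d + e = f) a (ha : a ∈ 𝒜 d) b (hb : b ∈ ℬ e),
      p (a ⊗ₜ b) (tmul_mem_tensorGr h ha hb))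
    {X : M ⊗[K] N} (hX : X ∈ tensorGr 𝒜 ℬ f) : p X hX := by
  refine Submodule.iSup_induction' _ (motive := p) ?_ zero
    (fun x y hx hy => add x y hx hy) hX
  rintro d _ ⟨x, rfl⟩
  induction x with
  | zero => simpa only [map_zero] using zero
  | add x y hx hy => simpa only [map_add] using add _ _ _ _ hx hy
  | tmul a b => exact tmul d (f - d) (by omega) a a.2 b b.2

@[elab_as_elim]
theorem homogeneous_induction (𝒜 : ℤ → Submodule K M) [DirectSum.Decomposition 𝒜] {p : M → Prop}
    (x : M) (zero : p 0) (add : ∀ x y, p x → p y → p (x + y)) (mem : ∀ d, ∀ a ∈ 𝒜 d, p a) :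
    p x :=
  DirectSum.Decomposition.inductionOn 𝒜 zero (fun {d} a => mem d a a.2) add x

-- Koszul signs are explicit only on homogeneous elements; by linearity the identities between maps
-- on tensor products are checked on homogeneous pure tensors.
@[elab_as_elim]
theorem homogeneous_tensor_induction (𝒜 : ℤ → Submodule K M) (ℬ : ℤ → Submodule K N)
    [DirectSum.Decomposition 𝒜] [DirectSum.Decomposition ℬ]
    {p : M ⊗[K] N → Prop} (X : M ⊗[K] N) (zero : p 0) (add : ∀ x y, p x → p y → p (x + y))
    (tmul : ∀ d e, ∀ a ∈ 𝒜 d, ∀ b ∈ ℬ e, p (a ⊗ₜ b)) : p X := by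
  induction X with
  | zero => exact zero
  | add x y hx hy => exact add _ _ hx hy
  | tmul a b =>
    refine homogeneous_induction 𝒜 (p := fun a => p (a ⊗ₜ b)) a (by simpa using zero)
      (fun x y hx hy => by rw [TensorProduct.add_tmul]; exact add _ _ hx hy) fun d a ha => ?_
    refine homogeneous_induction ℬ (p := fun b => p (a ⊗ₜ b)) b (by simpa using zero)
      (fun x y hx hy => by rw [TensorProduct.tmul_add]; exact add _ _ hx hy) fun e b hb => ?_
    exact tmul d e a ha b hb

variable (𝒜 ℬ) [DirectSum.Decomposition 𝒜] [DirectSum.Decomposition ℬ]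

/-- The product of two homogeneous elements, as a homogeneous tensor. -/
noncomputable def homogeneousTmul (d e : ℤ) : 𝒜 d →ₗ[K] ℬ e →ₗ[K] tensorGr 𝒜 ℬ (d + e) :=
  LinearMap.mk₂ K (fun a b => ⟨a.1 ⊗ₜ b.1, tmul_mem_tensorGr rfl a.2 b.2⟩)
    (fun _ _ _ => Subtype.ext (TensorProduct.add_tmul _ _ _))
    (fun _ _ _ => Subtype.ext (TensorProduct.smul_tmul' _ _ _))
    (fun _ _ _ => Subtype.ext (TensorProduct.tmul_add _ _ _))
    (fun _ _ _ => Subtype.ext (TensorProduct.tmul_smul _ _ _))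

/-- The decomposition of a tensor product into its homogeneous components. -/
noncomputable def tensorDecompose : M ⊗[K] N →ₗ[K] ⨁ f, tensorGr 𝒜 ℬ f :=
  TensorProduct.lift
    (LinearMap.compl₁₂
      (DirectSum.toModule K ℤ _ fun d => LinearMap.flip
        (DirectSum.toModule K ℤ _ fun e => LinearMap.flip
          ((homogeneousTmul 𝒜 ℬ d e).compr₂
            (DirectSum.lof K ℤ (fun f => tensorGr 𝒜 ℬ f) (d + e)))))
      (DirectSum.decomposeLinearEquiv 𝒜).toLinearMap
      (DirectSum.decomposeLinearEquiv ℬ).toLinearMap)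

variable {𝒜 ℬ}

theorem tensorDecompose_tmul {d e f : ℤ} (h : d + e = f) {a : M} {b : N} (ha : a ∈ 𝒜 d)
    (hb : b ∈ ℬ e) : tensorDecompose 𝒜 ℬ (a ⊗ₜ b) =
      DirectSum.lof K ℤ (fun f => tensorGr 𝒜 ℬ f) f ⟨a ⊗ₜ b, tmul_mem_tensorGr h ha hb⟩ := by
  subst h
  have h1 : DirectSum.decomposeLinearEquiv 𝒜 a = DirectSum.lof K ℤ (fun d => 𝒜 d) d ⟨a, ha⟩ :=
    DirectSum.decompose_of_mem 𝒜 ha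
  have h2 : DirectSum.decomposeLinearEquiv ℬ b = DirectSum.lof K ℤ (fun d => ℬ d) e ⟨b, hb⟩ :=
    DirectSum.decompose_of_mem ℬ hb
  simp only [tensorDecompose, TensorProduct.lift.tmul, LinearMap.compl₁₂_apply,
    LinearEquiv.coe_coe, h1, h2, DirectSum.toModule_lof, LinearMap.flip_apply,
    LinearMap.compr₂_apply]
  rfl

theorem tensorDecompose_of_mem {f : ℤ} {X : M ⊗[K] N} (hX : X ∈ tensorGr 𝒜 ℬ f) :
    tensorDecompose 𝒜 ℬ X = DirectSum.lof K ℤ (fun f => tensorGr 𝒜 ℬ f) f ⟨X, hX⟩ := by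
  suffices H : ∃ h : X ∈ tensorGr 𝒜 ℬ f,
      tensorDecompose 𝒜 ℬ X = DirectSum.lof K ℤ (fun f => tensorGr 𝒜 ℬ f) f ⟨X, h⟩ from
    H.choose_spec
  induction hX using tensorGr_induction with
  | zero => exact ⟨zero_mem _, by
      rw [map_zero, eq_comm]
      exact map_zero (DirectSum.lof K ℤ (fun f => tensorGr 𝒜 ℬ f) f)⟩
  | add x y _ _ ihx ihy =>
    obtain ⟨hx, ihx⟩ := ihx
    obtain ⟨hy, ihy⟩ := ihy
    refine ⟨add_mem hx hy, ?_⟩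
    rw [map_add, ihx, ihy, ← map_add]
    rfl
  | tmul d e h a ha b hb => exact ⟨tmul_mem_tensorGr h ha hb, tensorDecompose_tmul h ha hb⟩

variable (𝒜 ℬ)

/-- The tensor product of graded vector spaces is graded. -/
noncomputable instance tensorGrDecomposition : DirectSum.Decomposition (tensorGr 𝒜 ℬ) :=
  DirectSum.Decomposition.ofLinearMap _ (tensorDecompose 𝒜 ℬ)
    (LinearMap.ext fun X => by
      induction X using homogeneous_tensor_induction 𝒜 ℬ with
      | zero => simp
      | add x y hx hy => rw [map_add, hx, hy, map_add]
      | tmul d e a ha b hb =>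
        rw [LinearMap.comp_apply, tensorDecompose_tmul rfl ha hb, DirectSum.coeLinearMap_lof]
        rfl)
    (DirectSum.linearMap_ext K fun f => LinearMap.ext fun X => by
      rw [LinearMap.comp_apply, LinearMap.comp_apply, DirectSum.coeLinearMap_lof,
        tensorDecompose_of_mem X.2]
      rfl)

end TensorGrading

theorem koszul_tmul_sign {K M N : Type*} [Field K] [AddCommGroup M] [Module K M] [AddCommGroup N]
    [Module K N] (𝒜 : ℤ → Submodule K M) (ℬ : ℤ → Submodule K N) [DirectSum.Decomposition 𝒜]
    [DirectSum.Decomposition ℬ] {d e : ℤ} {a : M} {b : N} (ha : a ∈ 𝒜 d) (hb : b ∈ ℬ e) :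
    koszul 𝒜 ℬ (a ⊗ₜ[K] b) = koszulSign K (d * e) • (b ⊗ₜ[K] a) := by
  rw [koszul_tmul _ _ ha hb, negOne_pow_smul (K := K)]

/-! ### The Hadamard product of two operads -/

namespace GradedOperad

variable {K : Type*} [Field K]

theorem circ_par_sign (P : GradedOperad K) {n m p l l' q : ℕ} (i k : Fin n) (hik : i ≠ k)
    (h₁ : n + m = l + 1) (h₂ : l + p = q + 1) (h₃ : n + p = l' + 1) (h₄ : l' + m = q + 1) {d e : ℤ}
    (x : P.obj n) (y : P.obj m) (z : P.obj p) (hy : y ∈ P.gr m d) (hz : z ∈ P.gr p e) :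
    P.circ (outPos i h₁ k hik.symm) h₂ (P.circ i h₁ x y) z =
      koszulSign K (d * e) • P.circ (outPos k h₃ i hik) h₄ (P.circ k h₃ x z) y := by
  rw [P.circ_par i k hik h₁ h₂ h₃ h₄ x y z hy hz, negOne_pow_smul (K := K)]

section Hadamard

variable (P Q : GradedOperad K)

/-- The partial composition of the arity-wise tensor product of two operads. -/
noncomputable def hadamardCirc {n m l : ℕ} (i : Fin n) (h : n + m = l + 1) :
    (P.obj n ⊗[K] Q.obj n) ⊗[K] (P.obj m ⊗[K] Q.obj m) →ₗ[K] P.obj l ⊗[K] Q.obj l :=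
  TensorProduct.map (TensorProduct.lift (P.circ i h)) (TensorProduct.lift (Q.circ i h)) ∘ₗ
    (TensorProduct.assoc K (P.obj n) (P.obj m) (Q.obj n ⊗[K] Q.obj m)).symm.toLinearMap ∘ₗ
    TensorProduct.map LinearMap.id
      ((TensorProduct.assoc K (P.obj m) (Q.obj n) (Q.obj m)).toLinearMap ∘ₗ
        TensorProduct.map (koszul (Q.gr n) (P.gr m)) LinearMap.id ∘ₗ
        (TensorProduct.assoc K (Q.obj n) (P.obj m) (Q.obj m)).symm.toLinearMap) ∘ₗ
    (TensorProduct.assoc K (P.obj n) (Q.obj n) (P.obj m ⊗[K] Q.obj m)).toLinearMap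

theorem hadamardCirc_tmul {n m l : ℕ} (i : Fin n) (h : n + m = l + 1) {e f : ℤ}
    (a : P.obj n) {b : Q.obj n} {c : P.obj m} (d : Q.obj m)
    (hb : b ∈ Q.gr n e) (hc : c ∈ P.gr m f) :
    hadamardCirc P Q i h ((a ⊗ₜ b) ⊗ₜ (c ⊗ₜ d)) =
      koszulSign K (e * f) • (P.circ i h a c ⊗ₜ[K] Q.circ i h b d) := by
  simp only [hadamardCirc, LinearMap.comp_apply, LinearEquiv.coe_coe, TensorProduct.assoc_tmul,
    TensorProduct.map_tmul, TensorProduct.assoc_symm_tmul, koszul_tmul_sign _ _ hb hc,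
    LinearMap.id_apply, TensorProduct.smul_tmul',
    TensorProduct.tmul_smul, map_smul, LinearMap.smul_apply, TensorProduct.lift.tmul]

theorem hadamardCirc_mem {n m l : ℕ} (i : Fin n) (h : n + m = l + 1) {d e : ℤ}
    {X : P.obj n ⊗[K] Q.obj n} {Y : P.obj m ⊗[K] Q.obj m} (hX : X ∈ tensorGr (P.gr n) (Q.gr n) d)
    (hY : Y ∈ tensorGr (P.gr m) (Q.gr m) e) :
    hadamardCirc P Q i h (X ⊗ₜ Y) ∈ tensorGr (P.gr l) (Q.gr l) (d + e) := by
  induction hX using tensorGr_induction with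
  | zero => simp
  | add x y _ _ hx hy => rw [TensorProduct.add_tmul, map_add]; exact add_mem hx hy
  | tmul d₁ d₂ hd a ha b hb =>
    induction hY using tensorGr_induction with
    | zero => simp
    | add x y _ _ hx hy => rw [TensorProduct.tmul_add, map_add]; exact add_mem hx hy
    | tmul e₁ e₂ he a' ha' b' hb' =>
      rw [hadamardCirc_tmul _ _ _ _ _ _ hb ha']
      exact Submodule.smul_mem _ _ (tmul_mem_tensorGr (by omega) (P.circ_mem i h ha ha')
        (Q.circ_mem i h hb hb'))

/-- Both sides carry the same exponent, `e₁d₂ + (e₁ + e₂)d₃ = e₂d₃ + e₁(d₂ + d₃)`: each second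
factor passes every first factor that lies to its right. -/
theorem hadamardCirc_seq {n m p l l' q : ℕ} (i : Fin n) (j : Fin m) (h₁ : n + m = l + 1)
    (h₂ : l + p = q + 1) (h₃ : m + p = l' + 1) (h₄ : n + l' = q + 1)
    (X : P.obj n ⊗[K] Q.obj n) (Y : P.obj m ⊗[K] Q.obj m) (Z : P.obj p ⊗[K] Q.obj p) :
    hadamardCirc P Q (inPos i h₁ j) h₂ (hadamardCirc P Q i h₁ (X ⊗ₜ Y) ⊗ₜ Z) =
      hadamardCirc P Q i h₄ (X ⊗ₜ hadamardCirc P Q j h₃ (Y ⊗ₜ Z)) := by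
  induction X using homogeneous_tensor_induction (P.gr n) (Q.gr n) with
  | zero => simp
  | add x y hx hy => simp only [TensorProduct.add_tmul, map_add, hx, hy]
  | tmul d₁ e₁ a₁ ha₁ b₁ hb₁ =>
  induction Y using homogeneous_tensor_induction (P.gr m) (Q.gr m) with
  | zero => simp
  | add x y hx hy => simp only [TensorProduct.add_tmul, TensorProduct.tmul_add, map_add, hx, hy]
  | tmul d₂ e₂ a₂ ha₂ b₂ hb₂ =>
  induction Z using homogeneous_tensor_induction (P.gr p) (Q.gr p) with
  | zero => simp
  | add x y hx hy => simp only [TensorProduct.tmul_add, map_add, hx, hy]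
  | tmul d₃ e₃ a₃ ha₃ b₃ hb₃ =>
  rw [hadamardCirc_tmul _ _ _ _ _ _ hb₁ ha₂, hadamardCirc_tmul _ _ _ _ _ _ hb₂ ha₃,
    ← TensorProduct.smul_tmul', map_smul, TensorProduct.tmul_smul, map_smul,
    hadamardCirc_tmul _ _ _ _ _ _ (Q.circ_mem _ _ hb₁ hb₂) ha₃,
    hadamardCirc_tmul _ _ _ _ _ _ hb₁ (P.circ_mem _ _ ha₂ ha₃), P.circ_seq i j h₁ h₂ h₃ h₄,
    Q.circ_seq i j h₁ h₂ h₃ h₄, smul_smul, smul_smul, ← koszulSign_add, ← koszulSign_add]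
  congr 2
  ring

theorem hadamardCirc_par {n m p l l' q : ℕ} (i k : Fin n) (hik : i ≠ k) (h₁ : n + m = l + 1)
    (h₂ : l + p = q + 1) (h₃ : n + p = l' + 1) (h₄ : l' + m = q + 1) {d e : ℤ}
    (X : P.obj n ⊗[K] Q.obj n) (Y : P.obj m ⊗[K] Q.obj m) (Z : P.obj p ⊗[K] Q.obj p)
    (hY : Y ∈ tensorGr (P.gr m) (Q.gr m) d) (hZ : Z ∈ tensorGr (P.gr p) (Q.gr p) e) :
    hadamardCirc P Q (outPos i h₁ k hik.symm) h₂ (hadamardCirc P Q i h₁ (X ⊗ₜ Y) ⊗ₜ Z) =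
      koszulSign K (d * e) •
        hadamardCirc P Q (outPos k h₃ i hik) h₄ (hadamardCirc P Q k h₃ (X ⊗ₜ Z) ⊗ₜ Y) := by
  induction X using homogeneous_tensor_induction (P.gr n) (Q.gr n) with
  | zero => simp
  | add x y hx hy => simp only [TensorProduct.add_tmul, map_add, hx, hy, smul_add]
  | tmul d₁ e₁ a₁ ha₁ b₁ hb₁ =>
  induction hY using tensorGr_induction with
  | zero => simp
  | add x y _ _ hx hy =>
    simp only [TensorProduct.add_tmul, TensorProduct.tmul_add, map_add, hx, hy, smul_add]
  | tmul d₂ e₂ h a₂ ha₂ b₂ hb₂ =>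
  induction hZ using tensorGr_induction with
  | zero => simp
  | add x y _ _ hx hy =>
    simp only [TensorProduct.add_tmul, TensorProduct.tmul_add, map_add, hx, hy, smul_add]
  | tmul d₃ e₃ h' a₃ ha₃ b₃ hb₃ =>
  subst h h'
  rw [hadamardCirc_tmul _ _ _ _ _ _ hb₁ ha₂, hadamardCirc_tmul _ _ _ _ _ _ hb₁ ha₃,
    ← TensorProduct.smul_tmul', map_smul, ← TensorProduct.smul_tmul', map_smul,
    hadamardCirc_tmul _ _ _ _ _ _ (Q.circ_mem _ _ hb₁ hb₂) ha₃,
    hadamardCirc_tmul _ _ _ _ _ _ (Q.circ_mem _ _ hb₁ hb₃) ha₂,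
    P.circ_par_sign i k hik h₁ h₂ h₃ h₄ _ _ _ ha₂ ha₃,
    Q.circ_par_sign i k hik h₁ h₂ h₃ h₄ _ _ _ hb₂ hb₃]
  simp only [TensorProduct.tmul_smul, ← TensorProduct.smul_tmul', smul_smul, ← koszulSign_add]
  congr 1
  -- The parallel axioms of the two operads contribute `d₂d₃ + e₂e₃`, while the required sign has
  -- exponent `(d₂ + e₂)(d₃ + e₃)`. The cross terms are accounted for by the reorderings, up to
  -- `2e₃d₂`.
  refine koszulSign_congr ⟨-(e₃ * d₂), ?_⟩
  ring

theorem hadamardCirc_act {n m l : ℕ} (i : Fin n) (h : n + m = l + 1) (σ : Equiv.Perm (Fin n))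
    (τ : Equiv.Perm (Fin m)) (ρ : Equiv.Perm (Fin l)) (hρ : IsCompositePerm i h σ τ ρ)
    (X : P.obj n ⊗[K] Q.obj n) (Y : P.obj m ⊗[K] Q.obj m) :
    hadamardCirc P Q i h (TensorProduct.map (P.act σ) (Q.act σ) X ⊗ₜ
      TensorProduct.map (P.act τ) (Q.act τ) Y) =
      TensorProduct.map (P.act ρ) (Q.act ρ) (hadamardCirc P Q (σ i) h (X ⊗ₜ Y)) := by
  induction X using homogeneous_tensor_induction (P.gr n) (Q.gr n) with
  | zero => simp
  | add x y hx hy => simp only [TensorProduct.add_tmul, map_add, hx, hy]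
  | tmul d₁ e₁ a₁ ha₁ b₁ hb₁ =>
  induction Y using homogeneous_tensor_induction (P.gr m) (Q.gr m) with
  | zero => simp
  | add x y hx hy => simp only [TensorProduct.tmul_add, map_add, hx, hy]
  | tmul d₂ e₂ a₂ ha₂ b₂ hb₂ =>
  rw [TensorProduct.map_tmul, TensorProduct.map_tmul,
    hadamardCirc_tmul _ _ _ _ _ _ (Q.act_mem σ hb₁) (P.act_mem τ ha₂),
    hadamardCirc_tmul _ _ _ _ _ _ hb₁ ha₂, map_smul, TensorProduct.map_tmul,
    P.circ_act i h σ τ ρ hρ, Q.circ_act i h σ τ ρ hρ]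

/-- The Hadamard product of two operads, i.e. their arity-wise tensor product. -/
noncomputable abbrev hadamard : GradedOperad K where
  obj n := P.obj n ⊗[K] Q.obj n
  gr n := tensorGr (P.gr n) (Q.gr n)
  act σ := TensorProduct.map (P.act σ) (Q.act σ)
  circ i h := TensorProduct.curry (hadamardCirc P Q i h)
  one := P.one ⊗ₜ Q.one
  act_mem σ d X hX := by
    induction hX using tensorGr_induction with
    | zero => simp
    | add x y _ _ hx hy => rw [map_add]; exact add_mem hx hy
    | tmul d₁ d₂ hd a ha b hb =>
      exact tmul_mem_tensorGr hd (P.act_mem σ ha) (Q.act_mem σ hb)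
  circ_mem i h _ _ _ _ hX hY := hadamardCirc_mem P Q i h hX hY
  one_mem := tmul_mem_tensorGr (add_zero 0) P.one_mem Q.one_mem
  act_one X := by
    induction X with
    | zero => simp
    | add x y hx hy => rw [map_add, hx, hy]
    | tmul a b => rw [TensorProduct.map_tmul, P.act_one, Q.act_one]
  act_mul σ τ X := by
    induction X with
    | zero => simp
    | add x y hx hy => simp only [map_add, hx, hy]
    | tmul a b => simp only [TensorProduct.map_tmul, P.act_mul, Q.act_mul]
  one_circ {n} h X := by
    induction X using homogeneous_tensor_induction (P.gr n) (Q.gr n) with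
    | zero => simp
    | add x y hx hy => rw [map_add, hx, hy]
    | tmul d e a ha b hb =>
      rw [TensorProduct.curry_apply, hadamardCirc_tmul _ _ _ _ _ _ Q.one_mem ha, P.one_circ,
        Q.one_circ]
      simp
  circ_one {n} i h X := by
    induction X using homogeneous_tensor_induction (P.gr n) (Q.gr n) with
    | zero => simp
    | add x y hx hy => rw [map_add, LinearMap.add_apply, hx, hy]
    | tmul d e a ha b hb =>
      rw [TensorProduct.curry_apply, hadamardCirc_tmul _ _ _ _ _ _ hb P.one_mem, P.circ_one,
        Q.circ_one]
      simp
  circ_seq i j h₁ h₂ h₃ h₄ X Y Z := hadamardCirc_seq P Q i j h₁ h₂ h₃ h₄ X Y Z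
  circ_par i k hik h₁ h₂ h₃ h₄ d e X Y Z hY hZ := by
    rw [negOne_pow_smul (K := K)]
    exact hadamardCirc_par P Q i k hik h₁ h₂ h₃ h₄ X Y Z hY hZ
  circ_act i h σ τ ρ hρ X Y := hadamardCirc_act P Q i h σ τ ρ hρ X Y

end Hadamard

end GradedOperad

/-! ### Morphisms of operads; symmetry and associativity of the Hadamard product -/

namespace GradedOperad

variable {K : Type*} [Field K]

/-- A morphism of graded operads. -/
structure Hom (P Q : GradedOperad K) where
  app : ∀ n, P.obj n →ₗ[K] Q.obj n
  app_mem : ∀ {n : ℕ} {d : ℤ} {x : P.obj n}, x ∈ P.gr n d → app n x ∈ Q.gr n d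
  app_act : ∀ {n : ℕ} (σ : Equiv.Perm (Fin n)) (x : P.obj n),
    app n (P.act σ x) = Q.act σ (app n x)
  app_circ : ∀ {n m l : ℕ} (i : Fin n) (h : n + m = l + 1) (x : P.obj n) (y : P.obj m),
    app l (P.circ i h x y) = Q.circ i h (app n x) (app m y)
  app_one : app 1 P.one = Q.one

namespace Hom

variable {P P' Q Q' R : GradedOperad K}

/-- The identity morphism. -/
def id (P : GradedOperad K) : Hom P P where
  app _ := .id
  app_mem h := h
  app_act _ _ := rfl
  app_circ _ _ _ _ := rfl
  app_one := rfl

/-- The composite of two morphisms. -/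
def comp (g : Hom Q R) (f : Hom P Q) : Hom P R where
  app n := g.app n ∘ₗ f.app n
  app_mem h := g.app_mem (f.app_mem h)
  app_act σ x := by simp only [LinearMap.comp_apply, f.app_act, g.app_act]
  app_circ i h x y := by simp only [LinearMap.comp_apply, f.app_circ, g.app_circ]
  app_one := by simp only [LinearMap.comp_apply, f.app_one, g.app_one]

/-- The Hadamard product of two morphisms. -/
noncomputable def map (f : Hom P P') (g : Hom Q Q') : Hom (hadamard P Q) (hadamard P' Q') where
  app n := TensorProduct.map (f.app n) (g.app n)
  app_mem {n d X} hX := by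
    induction hX using tensorGr_induction with
    | zero => rw [map_zero]; exact zero_mem _
    | add x y _ _ hx hy => rw [map_add]; exact add_mem hx hy
    | tmul d₁ d₂ hd a ha b hb => exact tmul_mem_tensorGr hd (f.app_mem ha) (g.app_mem hb)
  app_act {n} σ X := by
    refine LinearMap.congr_fun (f := TensorProduct.map (f.app n) (g.app n) ∘ₗ
      TensorProduct.map (P.act σ) (Q.act σ)) (g := TensorProduct.map (P'.act σ) (Q'.act σ) ∘ₗ
        TensorProduct.map (f.app n) (g.app n)) (TensorProduct.ext' fun a b => ?_) X
    simp only [LinearMap.comp_apply, TensorProduct.map_tmul, f.app_act, g.app_act]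
  app_circ {n m l} i h X Y := by
    simp only [TensorProduct.curry_apply]
    induction X using homogeneous_tensor_induction (P.gr n) (Q.gr n) with
    | zero => simp
    | add x y hx hy => simp only [TensorProduct.add_tmul, map_add, hx, hy]
    | tmul d₁ e₁ a₁ ha₁ b₁ hb₁ =>
    induction Y using homogeneous_tensor_induction (P.gr m) (Q.gr m) with
    | zero => simp
    | add x y hx hy => simp only [TensorProduct.tmul_add, map_add, hx, hy]
    | tmul d₂ e₂ a₂ ha₂ b₂ hb₂ =>
    rw [TensorProduct.map_tmul, TensorProduct.map_tmul, hadamardCirc_tmul _ _ _ _ _ _ hb₁ ha₂,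
      hadamardCirc_tmul _ _ _ _ _ _ (g.app_mem hb₁) (f.app_mem ha₂), map_smul,
      TensorProduct.map_tmul, f.app_circ, g.app_circ]
  app_one := by rw [TensorProduct.map_tmul, f.app_one, g.app_one]

/-- The symmetry of the Hadamard product, with its Koszul sign. -/
noncomputable def swap (P Q : GradedOperad K) : Hom (hadamard P Q) (hadamard Q P) where
  app n := koszul (P.gr n) (Q.gr n)
  app_mem {n d X} hX := by
    induction hX using tensorGr_induction with
    | zero => rw [map_zero]; exact zero_mem _
    | add x y _ _ hx hy => rw [map_add]; exact add_mem hx hy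
    | tmul d₁ d₂ hd a ha b hb =>
      rw [koszul_tmul_sign _ _ ha hb]
      exact Submodule.smul_mem _ _ (tmul_mem_tensorGr (by omega) hb ha)
  app_act {n} σ X := by
    induction X using homogeneous_tensor_induction (P.gr n) (Q.gr n) with
    | zero => simp
    | add x y hx hy => simp only [map_add, hx, hy]
    | tmul d e a ha b hb =>
      rw [TensorProduct.map_tmul, koszul_tmul_sign _ _ ha hb,
        koszul_tmul_sign _ _ (P.act_mem σ ha) (Q.act_mem σ hb), map_smul, TensorProduct.map_tmul]
  app_circ {n m l} i h X Y := by
    simp only [TensorProduct.curry_apply]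
    induction X using homogeneous_tensor_induction (P.gr n) (Q.gr n) with
    | zero => simp
    | add x y hx hy => simp only [TensorProduct.add_tmul, map_add, hx, hy]
    | tmul d₁ e₁ a₁ ha₁ b₁ hb₁ =>
    induction Y using homogeneous_tensor_induction (P.gr m) (Q.gr m) with
    | zero => simp
    | add x y hx hy => simp only [TensorProduct.tmul_add, map_add, hx, hy]
    | tmul d₂ e₂ a₂ ha₂ b₂ hb₂ =>
    rw [koszul_tmul_sign _ _ ha₁ hb₁, koszul_tmul_sign _ _ ha₂ hb₂,
      hadamardCirc_tmul _ _ _ _ _ _ hb₁ ha₂, map_smul,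
      koszul_tmul_sign _ _ (P.circ_mem i h ha₁ ha₂) (Q.circ_mem i h hb₁ hb₂),
      ← TensorProduct.smul_tmul', map_smul, TensorProduct.tmul_smul, map_smul,
      hadamardCirc_tmul _ _ _ _ _ _ ha₁ hb₂]
    simp only [smul_smul, ← koszulSign_add]
    congr 1
    refine koszulSign_congr ⟨e₁ * d₂, ?_⟩
    ring
  app_one := by
    rw [koszul_tmul_sign _ _ P.one_mem Q.one_mem]
    simp

theorem hadamard_assoc_mem (P Q R : GradedOperad K) {n : ℕ} {d : ℤ}
    {X : (P.obj n ⊗[K] Q.obj n) ⊗[K] R.obj n}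
    (hX : X ∈ tensorGr (tensorGr (P.gr n) (Q.gr n)) (R.gr n) d) :
    TensorProduct.assoc K (P.obj n) (Q.obj n) (R.obj n) X ∈
      tensorGr (P.gr n) (tensorGr (Q.gr n) (R.gr n)) d := by
  induction hX using tensorGr_induction with
  | zero => rw [map_zero]; exact zero_mem _
  | add x y _ _ hx hy => rw [map_add]; exact add_mem hx hy
  | tmul d₁ d₂ hd a ha b hb =>
    induction ha using tensorGr_induction with
    | zero => rw [TensorProduct.zero_tmul, map_zero]; exact zero_mem _
    | add x y _ _ hx hy => rw [TensorProduct.add_tmul, map_add]; exact add_mem hx hy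
    | tmul e₁ e₂ he a ha c hc =>
      exact tmul_mem_tensorGr (by omega) ha (tmul_mem_tensorGr rfl hc hb)

theorem hadamard_assoc_act (P Q R : GradedOperad K) {n : ℕ} (σ : Equiv.Perm (Fin n))
    (X : (P.obj n ⊗[K] Q.obj n) ⊗[K] R.obj n) :
    TensorProduct.assoc K (P.obj n) (Q.obj n) (R.obj n)
        (TensorProduct.map (TensorProduct.map (P.act σ) (Q.act σ)) (R.act σ) X) =
      TensorProduct.map (P.act σ) (TensorProduct.map (Q.act σ) (R.act σ))
        (TensorProduct.assoc K (P.obj n) (Q.obj n) (R.obj n) X) := by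
  refine LinearMap.congr_fun (f := (TensorProduct.assoc K _ _ _).toLinearMap ∘ₗ
    TensorProduct.map (TensorProduct.map (P.act σ) (Q.act σ)) (R.act σ))
    (g := TensorProduct.map (P.act σ) (TensorProduct.map (Q.act σ) (R.act σ)) ∘ₗ
      (TensorProduct.assoc K _ _ _).toLinearMap) ?_ X
  exact TensorProduct.ext_threefold fun a b c => rfl

/-- The sign records `b₁` passing `a₂` and `c₁` passing both `a₂` and `b₂`. It does not depend on
the bracketing: `hadamardCirc_tmul_right` has the same exponent, which is why the associator
respects composition. -/
theorem hadamardCirc_tmul_left (P Q R : GradedOperad K) {n m l : ℕ} (i : Fin n)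
    (h : n + m = l + 1) {d₁ d₂ e₁ e₂ : ℤ} (a₁ : P.obj n) {b₁ : Q.obj n} {c₁ : R.obj n}
    {a₂ : P.obj m} {b₂ : Q.obj m} (c₂ : R.obj m) (hb₁ : b₁ ∈ Q.gr n d₁) (hc₁ : c₁ ∈ R.gr n e₁)
    (ha₂ : a₂ ∈ P.gr m d₂) (hb₂ : b₂ ∈ Q.gr m e₂) :
    hadamardCirc (hadamard P Q) R i h (((a₁ ⊗ₜ b₁) ⊗ₜ c₁) ⊗ₜ ((a₂ ⊗ₜ b₂) ⊗ₜ c₂)) =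
      koszulSign K (d₁ * d₂ + e₁ * (d₂ + e₂)) •
        ((P.circ i h a₁ a₂ ⊗ₜ[K] Q.circ i h b₁ b₂) ⊗ₜ[K] R.circ i h c₁ c₂) := by
  have h1 : (hadamard P Q).circ i h (a₁ ⊗ₜ b₁) (a₂ ⊗ₜ b₂) =
      koszulSign K (d₁ * d₂) • (P.circ i h a₁ a₂ ⊗ₜ[K] Q.circ i h b₁ b₂) :=
    hadamardCirc_tmul P Q i h a₁ b₂ hb₁ ha₂
  refine (hadamardCirc_tmul (hadamard P Q) R i h (a₁ ⊗ₜ b₁) c₂ hc₁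
    (tmul_mem_tensorGr rfl ha₂ hb₂)).trans ?_
  rw [h1, show d₁ * d₂ + e₁ * (d₂ + e₂) = e₁ * (d₂ + e₂) + d₁ * d₂ by ring, koszulSign_add,
    mul_smul]
  rfl

theorem hadamardCirc_tmul_right (P Q R : GradedOperad K) {n m l : ℕ} (i : Fin n)
    (h : n + m = l + 1) {d₁ d₂ e₁ e₂ : ℤ} (a₁ : P.obj n) {b₁ : Q.obj n} {c₁ : R.obj n}
    {a₂ : P.obj m} {b₂ : Q.obj m} (c₂ : R.obj m) (hb₁ : b₁ ∈ Q.gr n d₁) (hc₁ : c₁ ∈ R.gr n e₁)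
    (ha₂ : a₂ ∈ P.gr m d₂) (hb₂ : b₂ ∈ Q.gr m e₂) :
    hadamardCirc P (hadamard Q R) i h ((a₁ ⊗ₜ (b₁ ⊗ₜ c₁)) ⊗ₜ (a₂ ⊗ₜ (b₂ ⊗ₜ c₂))) =
      koszulSign K (d₁ * d₂ + e₁ * (d₂ + e₂)) •
        (P.circ i h a₁ a₂ ⊗ₜ[K] (Q.circ i h b₁ b₂ ⊗ₜ[K] R.circ i h c₁ c₂)) := by
  have h1 : (hadamard Q R).circ i h (b₁ ⊗ₜ c₁) (b₂ ⊗ₜ c₂) =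
      koszulSign K (e₁ * e₂) • (Q.circ i h b₁ b₂ ⊗ₜ[K] R.circ i h c₁ c₂) :=
    hadamardCirc_tmul Q R i h b₁ c₂ hc₁ hb₂
  refine (hadamardCirc_tmul P (hadamard Q R) i h a₁ (b₂ ⊗ₜ c₂)
    (tmul_mem_tensorGr rfl hb₁ hc₁) ha₂).trans ?_
  rw [h1, show d₁ * d₂ + e₁ * (d₂ + e₂) = (d₁ + e₁) * d₂ + e₁ * e₂ by ring, koszulSign_add,
    mul_smul]
  exact congrArg _ (TensorProduct.tmul_smul _ _ _)

theorem hadamard_assoc_circ (P Q R : GradedOperad K) {n m l : ℕ} (i : Fin n) (h : n + m = l + 1)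
    (X : (P.obj n ⊗[K] Q.obj n) ⊗[K] R.obj n) (Y : (P.obj m ⊗[K] Q.obj m) ⊗[K] R.obj m) :
    TensorProduct.assoc K (P.obj l) (Q.obj l) (R.obj l)
        (hadamardCirc (hadamard P Q) R i h (X ⊗ₜ Y)) =
      hadamardCirc P (hadamard Q R) i h (TensorProduct.assoc K (P.obj n) (Q.obj n) (R.obj n) X ⊗ₜ
        TensorProduct.assoc K (P.obj m) (Q.obj m) (R.obj m) Y) := by
  induction X using homogeneous_tensor_induction ((hadamard P Q).gr n) (R.gr n) with
  | zero => simp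
  | add x y hx hy => simp only [TensorProduct.add_tmul, map_add, hx, hy]
  | tmul d₁ e₁ a₁ ha₁ c₁ hc₁ =>
  induction Y using homogeneous_tensor_induction ((hadamard P Q).gr m) (R.gr m) with
  | zero => simp
  | add x y hx hy => simp only [TensorProduct.tmul_add, map_add, hx, hy]
  | tmul d₂ e₂ a₂ ha₂ c₂ hc₂ =>
  induction ha₁ using tensorGr_induction with
  | zero => simp
  | add x y _ _ hx hy => simp only [TensorProduct.add_tmul, map_add, hx, hy]
  | tmul f₁ g₁ hf₁ a₁ ha₁ b₁ hb₁ =>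
  induction ha₂ using tensorGr_induction with
  | zero => simp
  | add x y _ _ hx hy => simp only [TensorProduct.add_tmul, TensorProduct.tmul_add, map_add, hx, hy]
  | tmul f₂ g₂ hf₂ a₂ ha₂ b₂ hb₂ =>
  exact (congrArg _ (hadamardCirc_tmul_left P Q R i h a₁ c₂ hb₁ hc₁ ha₂ hb₂)).trans
    ((map_smul _ _ _).trans (hadamardCirc_tmul_right P Q R i h a₁ c₂ hb₁ hc₁ ha₂ hb₂).symm)

/-- The associativity of the Hadamard product. -/
noncomputable def assoc (P Q R : GradedOperad K) :
    Hom (hadamard (hadamard P Q) R) (hadamard P (hadamard Q R)) where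
  app n := (TensorProduct.assoc K (P.obj n) (Q.obj n) (R.obj n)).toLinearMap
  app_mem hX := hadamard_assoc_mem P Q R hX
  app_act σ X := hadamard_assoc_act P Q R σ X
  app_circ i h X Y := hadamard_assoc_circ P Q R i h X Y
  app_one := rfl

end Hom

/-! ### The operad `uCom`, target of the counit -/

/-- The grading of the ground field, in degree `0`. -/
def groundGr (K : Type*) [Field K] (d : ℤ) : Submodule K K := if d = 0 then ⊤ else ⊥

theorem mem_groundGr_zero (c : K) : c ∈ groundGr K 0 := by simp [groundGr]

theorem eq_zero_of_mem_groundGr {d : ℤ} (hd : d ≠ 0) {c : K} (hc : c ∈ groundGr K d) : c = 0 := by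
  simpa [groundGr, hd] using hc

noncomputable instance groundGrDecomposition : DirectSum.Decomposition (groundGr K) :=
  DirectSum.Decomposition.ofLinearMap _
    (DirectSum.lof K ℤ (fun d => groundGr K d) 0 ∘ₗ
      LinearMap.codRestrict (groundGr K 0) .id mem_groundGr_zero)
    (LinearMap.ext fun c => by
      rw [LinearMap.comp_apply, LinearMap.comp_apply, DirectSum.coeLinearMap_lof]; rfl)
    (DirectSum.linearMap_ext K fun d => LinearMap.ext fun c => by
      rw [LinearMap.comp_apply, LinearMap.comp_apply, DirectSum.coeLinearMap_lof]
      by_cases hd : d = 0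
      · subst hd; rfl
      · have : c = 0 := Subtype.ext (eq_zero_of_mem_groundGr hd c.2)
        simp [this])

/-- The operad of unital commutative algebras, with the ground field in every arity. -/
noncomputable abbrev uCom (K : Type*) [Field K] : GradedOperad K where
  obj _ := K
  gr _ := groundGr K
  act _ := .id
  circ _ _ := LinearMap.mul K K
  one := 1
  act_mem _ _ _ h := h
  circ_mem {n m l} i h d e x y hx hy := by
    by_cases hd : d = 0
    · by_cases he : e = 0
      · subst hd he; exact mem_groundGr_zero _
      · simp [eq_zero_of_mem_groundGr he hy]
    · simp [eq_zero_of_mem_groundGr hd hx]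
  one_mem := mem_groundGr_zero _
  act_one _ := rfl
  act_mul _ _ _ := rfl
  one_circ _ x := one_mul x
  circ_one _ _ x := mul_one x
  circ_seq _ _ _ _ _ _ x y z := mul_assoc x y z
  circ_par {n m p l l' q} i k hik h₁ h₂ h₃ h₄ d e x y z hy hz := by
    by_cases hd : d = 0
    · subst hd; simp [mul_right_comm]
    · simp [eq_zero_of_mem_groundGr hd hy]
  circ_act _ _ _ _ _ _ _ _ := rfl

namespace Hom

variable (P : GradedOperad K)

/-- The morphism `x ↦ 1 ⊗ x`. -/
noncomputable def oneTmul : Hom P (hadamard (uCom K) P) where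
  app n := TensorProduct.mk K K (P.obj n) 1
  app_mem h := tmul_mem_tensorGr (zero_add _) (mem_groundGr_zero 1) h
  app_act _ _ := rfl
  app_circ {n m l} i h x y := by
    simp only [TensorProduct.curry_apply, TensorProduct.mk_apply]
    induction x using homogeneous_induction (P.gr n) with
    | zero => simp
    | add x y hx hy => simp only [TensorProduct.add_tmul, TensorProduct.tmul_add, map_add,
        LinearMap.add_apply, hx, hy]
    | mem d x hx =>
      rw [hadamardCirc_tmul _ _ _ _ _ _ hx (mem_groundGr_zero 1)]
      simp
  app_one := rfl

/-- The morphism `x ↦ x ⊗ 1`. -/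
noncomputable def tmulOne : Hom P (hadamard P (uCom K)) where
  app n := (TensorProduct.mk K (P.obj n) K).flip 1
  app_mem h := tmul_mem_tensorGr (add_zero _) h (mem_groundGr_zero 1)
  app_act _ _ := rfl
  app_circ {n m l} i h x y := by
    simp only [TensorProduct.curry_apply, LinearMap.flip_apply, TensorProduct.mk_apply]
    induction y using homogeneous_induction (P.gr m) with
    | zero => simp
    | add x y hx hy => simp only [TensorProduct.add_tmul, TensorProduct.tmul_add, map_add, hx, hy]
    | mem d y hy =>
      rw [hadamardCirc_tmul _ _ _ _ _ _ (mem_groundGr_zero 1) hy]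
      simp
  app_one := rfl

end Hom

end GradedOperad

/-! ### The universal property of a presented operad -/

namespace OperadPresentation

open OpTerm GradedOperad

variable {K : Type*} [Field K] (Q : OperadPresentation K) (O : GradedOperad K)
  (g : ∀ n, Q.gen n → O.obj n)

/-- The value of a term in an operad, for given values of the generators. -/
def termValue : ∀ {n : ℕ}, OpTerm Q.gen n → O.obj n
  | _, .gen x => g _ x
  | _, .one => O.one
  | _, .act σ t => O.act σ (termValue t)
  | _, .circ i h s t => O.circ i h (termValue s) (termValue t)

/-- The value of a combination of terms in an operad, for given values of the generators. -/
noncomputable def eval (n : ℕ) : Comb K Q.gen n →ₗ[K] O.obj n :=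
  Finsupp.linearCombination K (Q.termValue O g)

variable {Q O g}

@[simp] theorem eval_single {n : ℕ} (t : OpTerm Q.gen n) :
    Q.eval O g n (single K t) = Q.termValue O g t := by
  simp [eval, single]

theorem eval_actC {n : ℕ} (σ : Equiv.Perm (Fin n)) (x : Comb K Q.gen n) :
    Q.eval O g n (actC σ x) = O.act σ (Q.eval O g n x) := by
  refine LinearMap.congr_fun (f := Q.eval O g n ∘ₗ actC σ) (g := O.act σ ∘ₗ Q.eval O g n) ?_ x
  refine comb_ext fun t => ?_
  simp [termValue]

theorem eval_circC {n m l : ℕ} (i : Fin n) (h : n + m = l + 1) (x : Comb K Q.gen n)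
    (y : Comb K Q.gen m) : Q.eval O g l (circC i h x y) =
      O.circ i h (Q.eval O g n x) (Q.eval O g m y) := by
  refine LinearMap.congr_fun₂ (f := (circC i h).compr₂ (Q.eval O g l))
    (g := (O.circ i h).compl₁₂ (Q.eval O g n) (Q.eval O g m)) ?_ x y
  refine comb_ext fun s => comb_ext fun t => ?_
  simp [termValue]

variable (hg : ∀ n x, g n x ∈ O.gr n (Q.deg n x))
include hg

/-- The parallel axiom for terms takes its sign from formal degrees, that of `O` from actual
degrees; the two match because evaluation preserves degree. -/
theorem termValue_mem {n : ℕ} (t : OpTerm Q.gen n) :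
    Q.termValue O g t ∈ O.gr n (OpTerm.deg Q.deg t) := by
  induction t with
  | gen x => exact hg _ x
  | one => exact O.one_mem
  | act σ t ih => exact O.act_mem σ ih
  | circ i h s t ihs iht => exact O.circ_mem i h ihs iht

theorem eval_mem {n : ℕ} {d : ℤ} {x : Comb K Q.gen n} (hx : x ∈ OpTerm.homog K Q.deg n d) :
    Q.eval O g n x ∈ O.gr n d := by
  rw [homog_eq_span] at hx
  induction hx using Submodule.span_induction with
  | mem x hx =>
    obtain ⟨t, rfl, rfl⟩ := hx
    rw [eval_single]
    exact termValue_mem hg t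
  | zero => rw [map_zero]; exact zero_mem _
  | add x y _ _ hx hy => rw [map_add]; exact add_mem hx hy
  | smul c x _ hx => rw [map_smul]; exact Submodule.smul_mem _ _ hx

variable (hrel : ∀ n x, Q.rel n x → Q.eval O g n x = 0)
include hrel

/-- The operad axioms hold in `O`, the given relations hold by `hrel`, and the kernel of evaluation
is stable under permutations and composition. -/
theorem eval_eq_zero {n : ℕ} {x : Comb K Q.gen n} (hx : Q.Rel n x) : Q.eval O g n x = 0 := by
  induction hx with
  | of_rel x hx => exact hrel _ x hx
  | act_one t => simp [termValue, O.act_one]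
  | act_mul σ τ t => simp [termValue, O.act_mul]
  | one_circ h t => simp [termValue, O.one_circ]
  | circ_one i h t => simp [termValue, O.circ_one]
  | circ_seq i j h₁ h₂ h₃ h₄ x y z =>
    simp [termValue, O.circ_seq i j h₁ h₂ h₃ h₄]
  | circ_par i k hik h₁ h₂ h₃ h₄ x y z =>
    rw [negOne_pow_smul (K := K), map_sub, map_smul, eval_single, eval_single, sub_eq_zero]
    exact O.circ_par_sign i k hik h₁ h₂ h₃ h₄ _ _ _ (termValue_mem hg y) (termValue_mem hg z)
  | circ_act i h σ τ ρ hρ x y => simp [termValue, O.circ_act i h σ τ ρ hρ]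
  | act σ x _ ih => rw [eval_actC, ih, map_zero]
  | circ_left i h x t _ ih => rw [eval_circC, ih, map_zero, LinearMap.zero_apply]
  | circ_right i h s y _ ih => rw [eval_circC, ih, map_zero]

/-- The morphism out of a presented operad given by the values of the generators. -/
noncomputable def lift : Hom Q.operad O where
  app n := (Q.relSpan n).liftQ (Q.eval O g n)
    (Submodule.span_le.2 fun _ hx => eval_eq_zero hg hrel hx)
  app_mem := by
    rintro n d _ ⟨x, hx, rfl⟩
    exact eval_mem hg hx
  app_act {n} σ x := by
    obtain ⟨x, rfl⟩ := Q.cls_surjective n x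
    exact eval_actC σ x
  app_circ {n m l} i h x y := by
    obtain ⟨x, rfl⟩ := Q.cls_surjective n x
    obtain ⟨y, rfl⟩ := Q.cls_surjective m y
    exact eval_circC i h x y
  app_one := eval_single .one

theorem lift_ofGen {n : ℕ} (x : Q.gen n) : (lift hg hrel).app n (Q.ofGen x) = g n x :=
  eval_single (.gen x)

omit hg hrel

theorem hom_ext {f f' : Hom Q.operad O}
    (h : ∀ n (x : Q.gen n), f.app n (Q.ofGen x) = f'.app n (Q.ofGen x)) (n : ℕ) :
    f.app n = f'.app n := by
  refine Q.obj_ext fun t => ?_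
  induction t with
  | gen x => exact h _ x
  | one => exact f.app_one.trans f'.app_one.symm
  | act σ t ih =>
    rw [← actC_single, ← objAct_cls]
    exact (f.app_act σ _).trans ((congrArg _ ih).trans (f'.app_act σ _).symm)
  | circ i h s t ihs iht =>
    rw [← circC_single, ← objCirc_cls]
    exact (f.app_circ i h _ _).trans
      ((congrArg₂ (fun a b => O.circ i h a b) ihs iht).trans (f'.app_circ i h _ _).symm)

end OperadPresentation

/-! ### Inputs of a composite and block permutations -/

section Positions

variable {n m l : ℕ} (i : Fin n) (h : n + m = l + 1)

@[simp] theorem inPos_val (j : Fin m) : (inPos i h j).1 = i.1 + j.1 := rfl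

theorem outPos_val (j : Fin n) (hj : j ≠ i) :
    (outPos i h j hj).1 = if j.1 < i.1 then j.1 else j.1 + m - 1 := by
  unfold outPos; split_ifs <;> rfl

/-- The inputs of a partial composite are those of the inner operation and all but one of those of
the outer operation. -/
theorem positions_bijective :
    Function.Bijective (Sum.elim (inPos i h) fun j : {j // j ≠ i} => outPos i h j.1 j.2) := by
  rw [Fintype.bijective_iff_injective_and_card]
  constructor
  · rintro (a | ⟨a, ha⟩) (b | ⟨b, hb⟩) hab <;>
      simp only [Sum.elim_inl, Sum.elim_inr, Fin.ext_iff, inPos_val, outPos_val] at hab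
    · exact congrArg _ (Fin.ext (by omega))
    · have := b.2; have := a.2; have := Fin.val_ne_of_ne hb
      split_ifs at hab <;> omega
    · have := b.2; have := a.2; have := Fin.val_ne_of_ne ha
      split_ifs at hab <;> omega
    · have := Fin.val_ne_of_ne ha; have := Fin.val_ne_of_ne hb
      obtain rfl : a = b := Fin.ext (by split_ifs at hab <;> omega)
      rfl
  · have := i.2
    simp only [Fintype.card_sum, Fintype.card_fin, ne_eq, Fintype.card_subtype_compl,
      Fintype.card_subtype_eq]
    omega

theorem exists_inPos_or_outPos (q : Fin l) :
    (∃ j, q = inPos i h j) ∨ ∃ j hj, q = outPos i h j hj := by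
  obtain ⟨a | ⟨a, ha⟩, rfl⟩ := (positions_bijective i h).2 q
  · exact Or.inl ⟨a, rfl⟩
  · exact Or.inr ⟨a, ha, rfl⟩

theorem inPos_injective : Function.Injective (inPos i h) := fun _ _ hab =>
  Sum.inl_injective ((positions_bijective i h).1 hab)

theorem outPos_injective {j k : Fin n} {hj : j ≠ i} {hk : k ≠ i}
    (hjk : outPos i h j hj = outPos i h k hk) : j = k :=
  congrArg Subtype.val (Sum.inr_injective
    ((positions_bijective i h).1 (a₁ := .inr ⟨j, hj⟩) (a₂ := .inr ⟨k, hk⟩) hjk))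

theorem inPos_ne_outPos (j : Fin m) (k : Fin n) (hk : k ≠ i) : inPos i h j ≠ outPos i h k hk :=
  fun e => Sum.inl_ne_inr ((positions_bijective i h).1 (a₁ := .inl j) (a₂ := .inr ⟨k, hk⟩) e)

/-- Both the source and the target inputs split as block and complement; transport `τ` on the block
and `σ` off `i` along the two splittings. -/
theorem exists_isCompositePerm (σ : Equiv.Perm (Fin n)) (τ : Equiv.Perm (Fin m)) :
    ∃ ρ : Equiv.Perm (Fin l), IsCompositePerm i h σ τ ρ := by
  refine ⟨(Equiv.ofBijective _ (positions_bijective i h)).symm.trans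
    ((Equiv.sumCongr τ (σ.subtypeEquiv (p := (· ≠ i)) (q := (· ≠ σ i)) (by simp))).trans
      (Equiv.ofBijective _ (positions_bijective (σ i) h))), fun j => ?_, fun j hj => ?_⟩
  · have : inPos i h j = Equiv.ofBijective _ (positions_bijective i h) (.inl j) := rfl
    rw [this, Equiv.trans_apply, Equiv.symm_apply_apply]
    rfl
  · have : outPos i h j hj = Equiv.ofBijective _ (positions_bijective i h) (.inr ⟨j, hj⟩) := rfl
    rw [this, Equiv.trans_apply, Equiv.symm_apply_apply]
    rfl

/-- A permutation carrying the block at `i` into the block at `j` restricts to a bijection `τ` of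
blocks, since they have equal size. It therefore matches their complements, and this matching,
extended by `i ↦ j`, is `σ`. -/
theorem exists_isCompositePerm_of_block (i j : Fin n) (h : n + m = l + 1)
    (ρ : Equiv.Perm (Fin l)) (hρ : ∀ a, ∃ b, ρ (inPos i h a) = inPos j h b) :
    ∃ σ : Equiv.Perm (Fin n), ∃ τ : Equiv.Perm (Fin m), σ i = j ∧ IsCompositePerm i h σ τ ρ := by
  choose t ht using hρ
  have ht_inj : Function.Injective t := fun a b hab =>
    inPos_injective i h (ρ.injective (by rw [ht, ht, hab]))
  have ht_surj := Finite.surjective_of_injective ht_inj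
  have hs : ∀ a : Fin n, ∃ b : Fin n, ∀ ha : a ≠ i, ∃ hb : b ≠ j,
      ρ (outPos i h a ha) = outPos j h b hb := fun a => by
    by_cases ha : a = i
    -- The value of `s` at `i` is arbitrary: it gets replaced by `j`.
    · exact ⟨a, fun ha' => (ha' ha).elim⟩
    · obtain ⟨c, hc⟩ | ⟨b, hb, hab⟩ := exists_inPos_or_outPos j h (ρ (outPos i h a ha))
      · obtain ⟨d, rfl⟩ := ht_surj c
        rw [← ht] at hc
        exact (inPos_ne_outPos i h d a ha (ρ.injective hc).symm).elim
      · exact ⟨b, fun _ => ⟨hb, hab⟩⟩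
  choose s hs using hs
  have hs_inj : Function.Injective fun a => if a = i then j else s a := by
    intro a b hab
    by_cases ha : a = i <;> by_cases hb : b = i <;> simp only [ha, hb, if_true, if_false] at hab
    · rw [ha, hb]
    · exact ((hs b hb).choose hab.symm).elim
    · exact ((hs a ha).choose hab).elim
    · refine outPos_injective i h (hj := ha) (hk := hb) (ρ.injective ?_)
      rw [(hs a ha).choose_spec, (hs b hb).choose_spec]
      simp only [hab]
  refine ⟨Equiv.ofBijective _ (Finite.injective_iff_bijective.1 hs_inj),
    Equiv.ofBijective t ⟨ht_inj, ht_surj⟩, by simp, fun a => ?_, fun a ha => ?_⟩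
  · rw [ht]; simp; rfl
  · rw [(hs a ha).choose_spec]
    simp [ha]

end Positions

namespace GradedOperad

variable {K : Type*} [Field K] (P : GradedOperad K)

/-- For symmetric `x` and `y`, a composite depends only on which inputs enter `y`. This replaces
permutations by sets of inputs from here on. -/
theorem act_circ_of_block {n m l : ℕ} (i j : Fin n) (h : n + m = l + 1) {x : P.obj n}
    {y : P.obj m} (hx : ∀ σ, P.act σ x = x) (hy : ∀ τ, P.act τ y = y) (ρ : Equiv.Perm (Fin l))
    (hρ : ∀ a, ∃ b, ρ (inPos i h a) = inPos j h b) :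
    P.act ρ (P.circ j h x y) = P.circ i h x y := by
  obtain ⟨σ, τ, rfl, hc⟩ := exists_isCompositePerm_of_block i j h ρ hρ
  rw [← P.circ_act i h σ τ ρ hc, hx, hy]

end GradedOperad

/-! ### The relations in the presented operad; symmetry of the iterated product -/

namespace uGerst

open OpTerm GradedOperad OperadPresentation

variable (K : Type*) [Field K] (r : ℕ)

variable {K r} in
theorem cls_eq_zero_of_isRel {n : ℕ} {x : Comb K (UGerstGen r) n} (hx : UGerst.IsRel K r n x) :
    (UGerst.presentation K r).cls n x = 0 :=
  (Submodule.Quotient.mk_eq_zero _).2 (Submodule.subset_span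
    (Rel.of_rel (Q := UGerst.presentation K r) x hx))

theorem act_mu (σ : Equiv.Perm (Fin 2)) : (uGerst K r).act σ (mu K r) = mu K r :=
  sub_eq_zero.1 ((map_sub _ _ _).symm.trans (cls_eq_zero_of_isRel (.mu_symm σ)))

theorem act_beta (σ : Equiv.Perm (Fin (r + 1))) : (uGerst K r).act σ (beta K r) = beta K r :=
  sub_eq_zero.1 ((map_sub _ _ _).symm.trans (cls_eq_zero_of_isRel (.beta_symm σ)))

theorem mu_circ_u : (uGerst K r).circ 0 (by omega) (mu K r) (u K r) = (uGerst K r).one :=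
  sub_eq_zero.1 ((map_sub _ _ _).symm.trans (cls_eq_zero_of_isRel .unit_mu))

theorem beta_circ_u : (uGerst K r).circ 0 (by omega) (beta K r) (u K r) =
    (0 : (uGerst K r).obj r) :=
  cls_eq_zero_of_isRel .unit_beta

theorem mu_assoc : (uGerst K r).circ 0 (by omega) (mu K r) (mu K r) =
    ((uGerst K r).circ 1 (by omega) (mu K r) (mu K r) : (uGerst K r).obj 3) :=
  sub_eq_zero.1 ((map_sub _ _ _).symm.trans (cls_eq_zero_of_isRel .assoc))

theorem leibniz : (uGerst K r).circ 0 (by omega) (beta K r) (mu K r) =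
    (uGerst K r).act (Fin.cycleIcc 1 (Fin.last (r + 1)))⁻¹
      ((uGerst K r).circ 0 (by omega) (mu K r) (beta K r)) +
      ((uGerst K r).circ 1 (by omega) (mu K r) (beta K r) : (uGerst K r).obj (r + 2)) :=
  sub_eq_zero.1 ((map_sub _ _ _).symm.trans (cls_eq_zero_of_isRel .leibniz))

theorem jacobi : ∑ σ ∈ UGerst.unshuffles r, (uGerst K r).act σ
    ((uGerst K r).circ 0 (by omega) (beta K r) (beta K r)) = (0 : (uGerst K r).obj (2 * r + 1)) :=
  (map_sum ((UGerst.presentation K r).cls _) _ _).symm.trans (cls_eq_zero_of_isRel .jacobi)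

theorem u_mem : u K r ∈ (uGerst K r).gr 0 0 := cls_mem (single_mem _)

theorem mu_mem : mu K r ∈ (uGerst K r).gr 2 0 := cls_mem (single_mem _)

theorem beta_mem : beta K r ∈ (uGerst K r).gr (r + 1) 1 := cls_mem (single_mem _)

theorem muPow_mem (p : ℕ) : muPow K r p ∈ (uGerst K r).gr (p + 1) 0 := by
  induction p with
  | zero => exact (uGerst K r).one_mem
  | succ p ih => exact (uGerst K r).circ_mem _ _ ih (mu_mem K r)

theorem mu_circ_zero_muPow (p : ℕ) (h : 2 + (p + 1) = p + 1 + 1 + 1) :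
    (uGerst K r).circ 0 h (mu K r) (muPow K r p) = muPow K r (p + 1) := by
  induction p with
  | zero => exact ((uGerst K r).circ_one 0 _ _).trans ((uGerst K r).one_circ _ _).symm
  | succ p ih =>
    refine ((uGerst K r).circ_seq 0 0 (l := p + 2) (by omega) (by omega) (by omega) h
      _ _ _).symm.trans ?_
    rw [ih]
    rfl

/-- Write `μ^(p+1)` as `μ ∘_0 μ^p`; associativity then turns `(μ ∘_1 μ) ∘_1 μ^p` into `(μ ∘_0 μ) ∘_1
μ^p = μ ∘_0 (μ ∘_1 μ^p)`, and induction applies to the inner composite. -/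
theorem mu_circ_one_muPow (p : ℕ) (h : 2 + (p + 1) = p + 1 + 1 + 1) :
    (uGerst K r).circ 1 h (mu K r) (muPow K r p) = muPow K r (p + 1) := by
  induction p with
  | zero => exact ((uGerst K r).circ_one 1 _ _).trans ((uGerst K r).one_circ _ _).symm
  | succ p ih =>
    have e₁ := (uGerst K r).circ_seq 1 0 (l := 3) (l' := p + 2) (q := p + 3) (by omega) (by omega)
      (by omega) (by omega) (mu K r) (mu K r) (muPow K r p)
    have e₂ := (uGerst K r).circ_seq 0 1 (l := 3) (l' := p + 2) (q := p + 3) (by omega) (by omega)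
      (by omega) (by omega) (mu K r) (mu K r) (muPow K r p)
    rw [mu_circ_zero_muPow K r p (by omega)] at e₁
    rw [ih (by omega), mu_circ_zero_muPow K r (p + 1) (by omega), mu_assoc K r] at e₂
    exact e₁.symm.trans e₂

/-- With at least three inputs, splitting off the last input shows invariance under transpositions
fixing it, and splitting off the first input those fixing the first. The one transposition left
exchanges first and last. -/
theorem act_muPow (p : ℕ) (σ : Equiv.Perm (Fin (p + 1))) :
    (uGerst K r).act σ (muPow K r p) = muPow K r p := by
  induction p with
  | zero =>
    obtain rfl : σ = 1 := Equiv.ext fun a => Fin.ext (by omega)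
    exact (uGerst K r).act_one _
  | succ p ih =>
    cases p with
    | zero =>
      have : muPow K r 1 = mu K r := (uGerst K r).one_circ _ _
      rw [this]
      exact act_mu K r σ
    | succ p =>
    have hm : 2 + (p + 2) = p + 3 + 1 := by omega
    have h0 : ∀ a b : Fin (p + 3), a ≠ Fin.last _ → b ≠ Fin.last _ →
        (uGerst K r).act (Equiv.swap a b) (muPow K r (p + 2)) = muPow K r (p + 2) := by
      intro a b ha hb
      rw [← mu_circ_zero_muPow K r (p + 1) hm]
      refine act_circ_of_block _ 0 0 _ (act_mu K r) ih _ fun c => ?_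
      have : Equiv.swap a b (inPos 0 hm c) ≠ Fin.last _ := by
        rw [← Equiv.swap_apply_of_ne_of_ne ha.symm hb.symm, Ne, (Equiv.swap a b).injective.eq_iff,
          Fin.ext_iff]
        simp only [inPos_val, Fin.val_zero, Fin.val_last]
        omega
      have := Fin.val_ne_of_ne this
      rw [Fin.val_last] at this
      refine ⟨(⟨(Equiv.swap a b (inPos 0 hm c)).1, by omega⟩ : Fin (p + 2)), Fin.ext ?_⟩
      simp
    have h1 : ∀ a b : Fin (p + 3), a ≠ 0 → b ≠ 0 →
        (uGerst K r).act (Equiv.swap a b) (muPow K r (p + 2)) = muPow K r (p + 2) := by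
      intro a b ha hb
      rw [← mu_circ_one_muPow K r (p + 1) hm]
      refine act_circ_of_block _ 1 1 _ (act_mu K r) ih _ fun c => ?_
      have h10 : ((1 : Fin 2) : ℕ) = 1 := rfl
      have : Equiv.swap a b (inPos 1 hm c) ≠ 0 := by
        rw [← Equiv.swap_apply_of_ne_of_ne ha.symm hb.symm, Ne, (Equiv.swap a b).injective.eq_iff,
          Fin.ext_iff, inPos_val, Fin.val_zero]
        omega
      have := Fin.val_ne_of_ne this
      rw [Fin.val_zero] at this
      refine ⟨(⟨(Equiv.swap a b (inPos 1 hm c)).1 - 1, by omega⟩ : Fin (p + 2)), Fin.ext ?_⟩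
      rw [inPos_val]
      dsimp only
      omega
    have h2 : (uGerst K r).act (Equiv.swap 0 (Fin.last _)) (muPow K r (p + 2)) =
        muPow K r (p + 2) := by
      -- It is conjugate to a transposition of the second kind by one of the first kind, via the
      -- middle input `1`.
      have e : Equiv.swap (0 : Fin (p + 3)) (Fin.last _) =
          Equiv.swap 1 0 * Equiv.swap (Fin.last _) 1 * Equiv.swap 1 0 :=
        (Equiv.swap_mul_swap_mul_swap (by simp [Fin.ext_iff]) (by simp [Fin.ext_iff])).symm
      rw [e, act_mul, act_mul, h0 1 0, h1, h0 1 0] <;> simp [Fin.ext_iff]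
    induction σ using Equiv.Perm.swap_induction_on with
    | one => exact (uGerst K r).act_one _
    | swap_mul f a b hab ihf =>
      suffices h : (uGerst K r).act (Equiv.swap a b) (muPow K r (p + 2)) = muPow K r (p + 2) by
        rw [act_mul, h, ihf]
      by_cases ha : a = 0
      · subst ha
        by_cases hb : b = Fin.last _
        · subst hb; exact h2
        · exact h0 _ _ (by simp [Fin.ext_iff]) hb
      · by_cases hb : b = 0
        · subst hb
          by_cases ha : a = Fin.last _
          · subst ha; rw [Equiv.swap_comm]; exact h2
          · exact h0 _ _ ha (by simp [Fin.ext_iff])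
        · exact h1 _ _ ha hb

theorem muPow_circ_muPow (p q : ℕ) (h : p + 1 + (q + 1) = p + q + 1 + 1) :
    (uGerst K r).circ 0 h (muPow K r p) (muPow K r q) = muPow K r (p + q) := by
  induction q with
  | zero => exact (uGerst K r).circ_one 0 _ _
  | succ q ih =>
    refine ((uGerst K r).circ_seq 0 0 (l := p + q + 1) (by omega) (by omega) (by omega) h
      _ _ _).symm.trans ?_
    rw [ih]
    rfl

theorem act_muPow_circ_muPow (p q : ℕ) {l : ℕ} (h : p + 1 + (q + 1) = l + 1)
    (σ : Equiv.Perm (Fin l)) :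
    (uGerst K r).act σ ((uGerst K r).circ 0 h (muPow K r p) (muPow K r q)) =
      (uGerst K r).circ 0 h (muPow K r p) (muPow K r q) := by
  obtain rfl : l = p + q + 1 := by omega
  rw [muPow_circ_muPow, act_muPow]

end uGerst

/-! ### Unshuffles as sets of inputs -/

section Shuffles

theorem perm_apply_inv_self {α : Type*} (σ : Equiv.Perm α) (a : α) : σ (σ⁻¹ a) = a :=
  σ.apply_symm_apply a

variable {l s t : ℕ} (T : Finset (Fin l)) (hT : T.card = s) (hl : l = s + t)

/-- The shuffle of the first `s` and the last `t` elements which maps the first `s` elements to a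
given set. -/
noncomputable def shuffleOf : Equiv.Perm (Fin l) :=
  (finCongr hl).trans (finSumFinEquiv.symm.trans (finSumEquivOfFinset hT
    (by rw [Finset.card_compl, hT, Fintype.card_fin]; omega)))

theorem shuffleOf_of_lt (a : Fin l) (ha : a.1 < s) :
    shuffleOf T hT hl a = T.orderEmbOfFin hT ⟨a.1, ha⟩ := by
  have : finCongr hl a = Fin.castAdd t ⟨a.1, ha⟩ := rfl
  rw [shuffleOf, Equiv.trans_apply, this, Equiv.trans_apply, finSumFinEquiv_symm_apply_castAdd,
    finSumEquivOfFinset_inl]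

theorem shuffleOf_of_le (a : Fin l) (ha : s ≤ a.1) :
    shuffleOf T hT hl a = Tᶜ.orderEmbOfFin
      (by rw [Finset.card_compl, hT, Fintype.card_fin]; omega) (⟨a.1 - s, by omega⟩ : Fin t) := by
  have : finCongr hl a = Fin.natAdd s ⟨a.1 - s, by omega⟩ := Fin.ext (by simp; omega)
  rw [shuffleOf, Equiv.trans_apply, this, Equiv.trans_apply, finSumFinEquiv_symm_apply_natAdd,
    finSumEquivOfFinset_inr]

theorem shuffleOf_mem_iff (a : Fin l) : shuffleOf T hT hl a ∈ T ↔ a.1 < s := by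
  constructor
  · contrapose!
    intro ha
    rw [shuffleOf_of_le _ _ _ _ ha, ← Finset.mem_compl]
    exact Finset.orderEmbOfFin_mem _ _ _
  · intro ha
    rw [shuffleOf_of_lt _ _ _ _ ha]
    exact Finset.orderEmbOfFin_mem _ _ _

theorem shuffleOf_lt {a b : Fin l} (hab : a < b) (h : b.1 < s ∨ s ≤ a.1) :
    shuffleOf T hT hl a < shuffleOf T hT hl b := by
  rw [Fin.lt_def] at hab
  obtain h | h := h
  · rw [shuffleOf_of_lt _ _ _ _ h, shuffleOf_of_lt _ _ _ _ (by omega), OrderEmbedding.lt_iff_lt]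
    exact hab
  · rw [shuffleOf_of_le _ _ _ _ h, shuffleOf_of_le _ _ _ _ (by omega), OrderEmbedding.lt_iff_lt,
      Fin.lt_def]
    dsimp only
    omega

/-- A finite set has only one increasing enumeration; this applies to `T` and to its complement. -/
theorem eq_shuffleOf {e : Equiv.Perm (Fin l)} (he : ∀ a, e a ∈ T ↔ a.1 < s)
    (hlt : ∀ a b, a < b → (b.1 < s ∨ s ≤ a.1) → e a < e b) : e = shuffleOf T hT hl := by
  ext1 a
  by_cases ha : a.1 < s
  · rw [shuffleOf_of_lt _ _ _ _ ha]
    have := Finset.orderEmbOfFin_unique hT (f := fun b : Fin s => e ⟨b.1, by omega⟩)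
      (fun b => (he _).2 b.2) (fun b c hbc => hlt _ _ hbc (Or.inl c.2))
    exact congrFun this ⟨a.1, ha⟩
  · rw [shuffleOf_of_le _ _ _ _ (not_lt.1 ha)]
    have hc : Tᶜ.card = t := by rw [Finset.card_compl, hT, Fintype.card_fin]; omega
    have := Finset.orderEmbOfFin_unique hc (f := fun b : Fin t => e ⟨s + b.1, by omega⟩)
      (fun b => by rw [Finset.mem_compl, he]; dsimp only; omega)
      (fun b c hbc => hlt _ _ (by rw [Fin.lt_def] at hbc ⊢; dsimp only; omega)
        (Or.inr (Nat.le_add_right _ _)))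
    refine Eq.trans (congrArg e (Fin.ext ?_)) (congrFun this ⟨a.1 - s, by omega⟩)
    dsimp only
    omega

theorem exists_perm_of_card (hT : T.card = s) (hs : s ≤ l) :
    ∃ σ : Equiv.Perm (Fin l), ∀ q, q ∈ T ↔ (σ q).1 < s :=
  ⟨(shuffleOf T hT (t := l - s) (by omega))⁻¹, fun q => by
    rw [← shuffleOf_mem_iff T hT (t := l - s) (by omega), perm_apply_inv_self]⟩

theorem card_of_perm (σ : Equiv.Perm (Fin l)) (hs : s ≤ l) :
    (Finset.univ.filter fun q => (σ q).1 < s).card = s := by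
  have : Finset.univ.filter (fun q => (σ q).1 < s) =
      (Finset.univ.filter fun q : Fin l => q.1 < s).map σ.symm.toEmbedding := by
    ext q; simp [Finset.mem_map_equiv]
  rw [this, Finset.card_map, Fin.card_filter_val_lt]
  omega

/-- A sum over unshuffles is a sum over the sets of inputs which are moved to the front. -/
theorem sum_unshuffles {M : Type*} [AddCommMonoid M] (r : ℕ) (f : Equiv.Perm (Fin (2 * r + 1)) → M)
    (g : Finset (Fin (2 * r + 1)) → M)
    (hfg : ∀ σ, f σ = g (Finset.univ.filter fun q => (σ q).1 < r + 1)) :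
    ∑ σ ∈ UGerst.unshuffles r, f σ =
      ∑ T ∈ Finset.powersetCard (r + 1) Finset.univ, g T := by
  have hl : 2 * r + 1 = (r + 1) + r := by omega
  -- An unshuffle is recovered from the set of inputs it moves to the front, which gives injectivity
  -- below.
  have key : ∀ σ ∈ UGerst.unshuffles r,
      σ⁻¹ = shuffleOf _ (card_of_perm σ (s := r + 1) (by omega)) hl := by
    intro σ hσ
    rw [UGerst.unshuffles, Finset.mem_filter] at hσ
    exact eq_shuffleOf _ _ _ (by simp) fun a b hab h => hσ.2 a b hab (by omega)
  refine Finset.sum_bij (fun σ _ => Finset.univ.filter fun q => (σ q).1 < r + 1) ?_ ?_ ?_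
    fun σ _ => hfg σ
  · intro σ _
    exact Finset.mem_powersetCard.2 ⟨Finset.subset_univ _, card_of_perm σ (by omega)⟩
  · intro σ hσ τ hτ h
    have h1 := key σ hσ
    simp only [h] at h1
    exact inv_injective (h1.trans (key τ hτ).symm)
  · intro T hT
    rw [Finset.mem_powersetCard] at hT
    refine ⟨(shuffleOf T hT.2 hl)⁻¹, ?_, ?_⟩
    · rw [UGerst.unshuffles, Finset.mem_filter]
      refine ⟨Finset.mem_univ _, fun a b hab h => ?_⟩
      rw [inv_inv]
      exact shuffleOf_lt _ _ _ hab (by omega)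
    · ext q
      rw [Finset.mem_filter, ← shuffleOf_mem_iff T hT.2 hl, perm_apply_inv_self]
      simp

end Shuffles

/-! ### Brackets times products, and the iterated Leibniz rule -/

namespace uGerst

open OpTerm GradedOperad OperadPresentation

variable (K : Type*) [Field K] (r : ℕ)

open Classical in
/-- The product of `p` inputs with the bracket of the inputs in `T`. -/
noncomputable def bracketOf (p : ℕ) {l : ℕ} (h : p + 1 + (r + 1) = l + 1) (T : Finset (Fin l)) :
    (uGerst K r).obj l :=
  if hT : ∃ σ : Equiv.Perm (Fin l), ∀ q, q ∈ T ↔ (σ q).1 < r + 1 then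
    (uGerst K r).act hT.choose ((uGerst K r).circ 0 h (muPow K r p) (beta K r))
  -- Default value: a suitable permutation exists exactly when `T` has `r + 1` elements.
  else 0

variable {p l : ℕ} (h : p + 1 + (r + 1) = l + 1)

/-- The choice in `bracketOf` is immaterial: two admissible permutations differ by one preserving
the block of `β`, which fixes `μ^p ∘_0 β` because both factors are symmetric. -/
theorem act_muPow_circ_beta {T : Finset (Fin l)} (σ : Equiv.Perm (Fin l))
    (hσ : ∀ q, q ∈ T ↔ (σ q).1 < r + 1) :
    (uGerst K r).act σ ((uGerst K r).circ 0 h (muPow K r p) (beta K r)) = bracketOf K r p h T := by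
  have hT : ∃ σ : Equiv.Perm (Fin l), ∀ q, q ∈ T ↔ (σ q).1 < r + 1 := ⟨σ, hσ⟩
  have hc := hT.choose_spec
  rw [bracketOf, dif_pos hT]
  generalize hT.choose = τ at hc
  have : (uGerst K r).act (σ * τ⁻¹) ((uGerst K r).circ 0 h (muPow K r p) (beta K r)) =
      (uGerst K r).circ 0 h (muPow K r p) (beta K r) := by
    refine act_circ_of_block _ 0 0 h (act_muPow K r p) (act_beta K r) _ fun a => ?_
    have h1 : (σ (τ⁻¹ (inPos 0 h a))).1 < r + 1 := by
      rw [← hσ, hc, perm_apply_inv_self, inPos_val, Fin.val_zero]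
      omega
    exact ⟨⟨_, h1⟩, Fin.ext (by simp)⟩
  rw [← inv_mul_cancel_right σ τ, act_mul, this]

theorem act_bracketOf {T T' : Finset (Fin l)} (σ : Equiv.Perm (Fin l))
    (hσ : ∀ q, q ∈ T' ↔ σ q ∈ T) :
    (uGerst K r).act σ (bracketOf K r p h T) = bracketOf K r p h T' := by
  by_cases hT : ∃ τ : Equiv.Perm (Fin l), ∀ q, q ∈ T ↔ (τ q).1 < r + 1
  · obtain ⟨τ, hτ⟩ := hT
    rw [← act_muPow_circ_beta K r h τ hτ, ← act_mul]
    exact act_muPow_circ_beta K r h _ fun q => by rw [hσ, hτ, Equiv.Perm.mul_apply]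
  -- The default value is taken for `T` and `T'` simultaneously.
  · have hT' : ¬ ∃ τ : Equiv.Perm (Fin l), ∀ q, q ∈ T' ↔ (τ q).1 < r + 1 := fun ⟨τ, hτ⟩ =>
      hT ⟨τ * σ⁻¹, fun q => by
        rw [Equiv.Perm.mul_apply, ← hτ, hσ, perm_apply_inv_self]⟩
    rw [bracketOf, dif_neg hT, map_zero, bracketOf, dif_neg hT']

/-- As `μ^p` is symmetric, its slot `j` may be exchanged with slot `0`; only the block of inputs
entering `β` is remembered. -/
theorem muPow_circ_beta (j : Fin (p + 1)) {T : Finset (Fin l)}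
    (hT : ∀ q, q ∈ T ↔ j.1 ≤ q.1 ∧ q.1 < j.1 + (r + 1)) :
    (uGerst K r).circ j h (muPow K r p) (beta K r) = bracketOf K r p h T := by
  obtain ⟨ρ, hρ⟩ := exists_isCompositePerm j h (Equiv.swap j 0) 1
  have e := (uGerst K r).circ_act j h _ _ ρ hρ (muPow K r p) (beta K r)
  rw [act_muPow, act_beta, Equiv.swap_apply_left] at e
  refine e.trans (act_muPow_circ_beta K r h ρ fun q => ?_)
  rw [hT]
  obtain ⟨a, rfl⟩ | ⟨a, ha, rfl⟩ := exists_inPos_or_outPos j h q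
  · rw [hρ.1, inPos_val, inPos_val, Equiv.swap_apply_left, Fin.val_zero, Equiv.Perm.one_apply]
    omega
  · have h0 : Equiv.swap j 0 a ≠ 0 := fun e =>
      ha ((Equiv.swap j 0).injective (e.trans (Equiv.swap_apply_left j 0).symm))
    have := Fin.val_ne_of_ne h0
    have := Fin.val_ne_of_ne ha
    rw [hρ.2 a ha, outPos_val, outPos_val, Equiv.swap_apply_left]
    rw [Fin.val_zero] at *
    split_ifs <;> omega

/-- The new factor is the last input and stays outside the bracket; by the sequential axiom the
outer `μ` is absorbed into the power. -/
theorem mu_circ_bracketOf (h' : p + 1 + 1 + (r + 1) = l + 1 + 1) (h₂ : 2 + l = l + 1 + 1)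
    {T : Finset (Fin l)} {T' : Finset (Fin (l + 1))} (hT : T.card = r + 1)
    (hT' : ∀ q, q ∈ T' ↔ ∃ a ∈ T, q.1 = a.1) :
    (uGerst K r).circ 0 h₂ (mu K r) (bracketOf K r p h T) = bracketOf K r (p + 1) h' T' := by
  obtain ⟨σ, hσ⟩ := exists_perm_of_card T hT (by omega)
  obtain ⟨ρ, hρ⟩ := exists_isCompositePerm 0 h₂ 1 σ
  have e := (uGerst K r).circ_act 0 h₂ _ _ ρ hρ (mu K r)
    ((uGerst K r).circ 0 h (muPow K r p) (beta K r))
  rw [act_mu, act_muPow_circ_beta K r h σ hσ, Equiv.Perm.one_apply] at e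
  have e₂ := (uGerst K r).circ_seq 0 0 (l := p + 1 + 1) (l' := l) (q := l + 1) (by omega) h' h h₂
    (mu K r) (muPow K r p) (beta K r)
  rw [mu_circ_zero_muPow] at e₂
  rw [e, ← e₂]
  refine act_muPow_circ_beta K r h' ρ fun q => ?_
  rw [hT']
  obtain ⟨a, rfl⟩ | ⟨a, ha, rfl⟩ := exists_inPos_or_outPos 0 h₂ q
  · rw [hρ.1, inPos_val, inPos_val, Equiv.Perm.one_apply, Fin.val_zero, zero_add, zero_add, ← hσ]
    exact ⟨fun ⟨b, hb, hab⟩ => Fin.ext hab ▸ hb, fun ha => ⟨a, ha, rfl⟩⟩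
  · rw [hρ.2 a ha, outPos_val, outPos_val]
    have := Fin.val_ne_of_ne ha
    simp only [Equiv.Perm.one_apply, Fin.val_zero, not_lt_zero, if_false] at *
    constructor
    · rintro ⟨b, _, hb⟩; omega
    · intro hh; omega

/-- Makes the cycle of the Leibniz relation explicit, so that membership in the sets of bracketed
inputs becomes arithmetic. -/
theorem cycleIcc_inv_val (j : Fin (r + 2)) : ((Fin.cycleIcc 1 (Fin.last (r + 1)))⁻¹ j).1 =
    if j.1 = 0 then 0 else if j.1 = 1 then r + 1 else j.1 - 1 := by
  have h1 : ((1 : Fin (r + 2)) : ℕ) = 1 := rfl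
  split_ifs with h0 h1'
  · have : j = 0 := Fin.ext h0
    subst this
    rw [Equiv.Perm.inv_eq_iff_eq.2 (Fin.cycleIcc_of_lt (by simp)).symm]
    rfl
  · have : j = 1 := Fin.ext (by omega)
    subst this
    rw [Equiv.Perm.inv_eq_iff_eq.2 (Fin.cycleIcc_of_last (Fin.le_last _)).symm]
    rfl
  · have e : Fin.cycleIcc 1 (Fin.last (r + 1)) ⟨j.1 - 1, by omega⟩ = j := by
      rw [Fin.cycleIcc_of_ge_of_lt (by rw [Fin.le_def, h1]; dsimp only; omega)
        (by rw [Fin.lt_def, Fin.val_last]; dsimp only; omega)]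
      refine Fin.ext ?_
      rw [Fin.val_add_one_of_lt (by rw [Fin.lt_def, Fin.val_last]; dsimp only; omega)]
      dsimp only
      omega
    rw [Equiv.Perm.inv_eq_iff_eq.2 e.symm]

/-- One of the first `p + 1` inputs, together with all other inputs. -/
def pickedSet (p l : ℕ) (i : ℕ) : Finset (Fin l) :=
  Finset.univ.filter fun q => q.1 = i ∨ p < q.1

theorem mem_pickedSet {p l i : ℕ} {q : Fin l} : q ∈ pickedSet p l i ↔ q.1 = i ∨ p < q.1 := by
  simp [pickedSet]

include h in
theorem card_pickedSet {i : ℕ} (hi : i ≤ p) : (pickedSet p l i).card = r + 1 := by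
  have : pickedSet p l i = insert (⟨i, by omega⟩ : Fin l) (Finset.Ioi ⟨p, by omega⟩) := by
    ext q; simp [mem_pickedSet, Fin.ext_iff, Fin.lt_def]
  rw [this, Finset.card_insert_of_notMem (by simp [hi]), Fin.card_Ioi]
  dsimp only
  omega

/-- The Leibniz relation for products of several factors. -/
theorem beta_circ_muPow (h₂ : r + 1 + (p + 1) = l + 1) :
    (uGerst K r).circ 0 h₂ (beta K r) (muPow K r p) =
      ∑ i : Fin (p + 1), bracketOf K r p h (pickedSet p l i) := by
  induction p generalizing l with
  | zero =>
    rw [Fin.sum_univ_one]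
    obtain rfl : l = r + 1 := by omega
    refine ((uGerst K r).circ_one 0 _ _).trans ?_
    rw [← muPow_circ_beta K r h 0 (fun q => by rw [mem_pickedSet, Fin.val_zero]; omega)]
    exact ((uGerst K r).one_circ (by omega) _).symm
  | succ p ih =>
    obtain ⟨l, rfl⟩ : ∃ l', l = l' + 1 := ⟨l - 1, by omega⟩
    have hb : p + 1 + (r + 1) = l + 1 := by omega
    have hμ : 2 + l = l + 1 + 1 := by omega
    have hs : r + 2 + (p + 1) = l + 1 + 1 := by omega
    have e₁ := (uGerst K r).circ_seq 0 0 (l := r + 2) (l' := p + 1 + 1) (q := l + 1) (by omega) hs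
      (by omega) h₂ (beta K r) (mu K r) (muPow K r p)
    rw [mu_circ_zero_muPow, leibniz, map_add, LinearMap.add_apply] at e₁
    refine e₁.symm.trans ?_
    -- Since `μ^(p+1) = μ ∘_0 μ^p`, one Leibniz step leaves two terms. Where `μ^p` stands inside
    -- `β`, induction gives the summands `i ≤ p`; where it stands outside, only the last factor is
    -- bracketed, which is the summand `i = p + 1`.
    rw [Fin.sum_univ_castSucc]
    congr 1
    · obtain ⟨ρ, hρ⟩ := exists_isCompositePerm (0 : Fin (r + 2)) hs
        (Fin.cycleIcc 1 (Fin.last (r + 1)))⁻¹ 1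
      have e₂ := (uGerst K r).circ_act 0 hs _ _ ρ hρ
        ((uGerst K r).circ 0 (by omega) (mu K r) (beta K r)) (muPow K r p)
      have e₃ := (uGerst K r).circ_seq 0 0 (l := r + 2) (l' := l) (q := l + 1) (by omega) hs
        (by omega) hμ (mu K r) (beta K r) (muPow K r p)
      have hc : (Fin.cycleIcc 1 (Fin.last (r + 1)))⁻¹ 0 = 0 :=
        Fin.ext ((cycleIcc_inv_val r 0).trans (by simp))
      rw [ih hb, map_sum] at e₃
      rw [act_muPow, hc] at e₂
      refine (e₂.trans (congrArg _ e₃)).trans ?_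
      rw [map_sum]
      refine Finset.sum_congr rfl fun i _ => ?_
      rw [mu_circ_bracketOf K r hb h hμ (card_pickedSet r hb (by omega))
        -- Before `ρ` acts, the factor outside `β` is the last input, at position `l`, and must be
        -- excluded; `ρ` sends the input `p + 1` to it.
        (T' := Finset.univ.filter fun q => q.1 < l ∧ (q.1 = i.1 ∨ p < q.1)) (fun q => ?_)]
      · refine act_bracketOf K r h ρ fun q => ?_
        rw [mem_pickedSet, Finset.mem_filter, Fin.val_castSucc]
        simp only [Finset.mem_univ, true_and]
        obtain ⟨a, rfl⟩ | ⟨a, ha, rfl⟩ := exists_inPos_or_outPos 0 hs q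
        · rw [hρ.1, hc]
          simp only [inPos_val, Fin.val_zero, Equiv.Perm.one_apply]
          omega
        · have := Fin.val_ne_of_ne ha
          have h3 := cycleIcc_inv_val r a
          rw [hρ.2 a ha, outPos_val, outPos_val, hc, h3]
          simp only [Fin.val_zero, not_lt_zero, if_false] at *
          split_ifs <;> omega
      · simp only [mem_pickedSet, Finset.mem_filter, Finset.mem_univ, true_and]
        exact ⟨fun ⟨hq, h⟩ => ⟨⟨q.1, hq⟩, h, rfl⟩, fun ⟨a, ha, haq⟩ => by rw [haq]; exact ⟨a.2, ha⟩⟩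
    -- Interchanging `β` and `μ^p` costs no sign since `μ^p` has degree `0`; the result is `μ^(p+1)`
    -- with `β` in its last slot.
    · have e₂ := (uGerst K r).circ_par_sign 1 0 (by simp) (l := r + 2) (l' := p + 1 + 1)
        (q := l + 1) (by omega) hs (by omega) h (mu K r) (beta K r) (muPow K r p) (beta_mem K r)
        (muPow_mem K r p)
      rw [mu_circ_zero_muPow, mul_zero, koszulSign_zero, one_smul] at e₂
      refine e₂.trans ?_
      refine muPow_circ_beta K r h _ fun q => ?_
      rw [mem_pickedSet, outPos_val, Fin.val_last]
      have h1 : ((1 : Fin 2) : ℕ) = 1 := rfl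
      simp only [Fin.val_zero, h1, not_lt_zero, if_false]
      omega

end uGerst

/-! ### Cancellation of the mixed Jacobi terms -/

namespace uGerst

open OpTerm GradedOperad OperadPresentation

variable (K : Type*) [Field K] (r : ℕ)

/-- A set of `r + 1` inputs covers everything together with `T` iff it contains the `r` elements of
`Tᶜ`, and then it has exactly one further element `j ∈ T`. The covering condition is used because it
is symmetric in the two sets. -/
theorem sum_insert_compl {M : Type*} [AddCommMonoid M] {T : Finset (Fin (2 * r + 1))}
    (hT : T.card = r + 1) (g : Finset (Fin (2 * r + 1)) → M) :
    ∑ j ∈ T, g (insert j Tᶜ) =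
      ∑ T' ∈ Finset.powersetCard (r + 1) Finset.univ, if T ∪ T' = Finset.univ then g T' else 0 := by
  have hc : Tᶜ.card = r := by rw [Finset.card_compl, hT, Fintype.card_fin]; omega
  rw [← Finset.sum_filter]
  refine Finset.sum_bij (fun j _ => insert j Tᶜ) (fun j hj => ?_) (fun j hj k hk hjk => ?_)
    (fun T' hT' => ?_) fun _ _ => rfl
  · rw [Finset.mem_filter, Finset.mem_powersetCard, Finset.card_insert_of_notMem (by simpa), hc]
    exact ⟨⟨Finset.subset_univ _, rfl⟩, by simp [Finset.union_insert]⟩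
  · have : j ∈ insert k Tᶜ := hjk ▸ Finset.mem_insert_self j _
    simpa [hj] using this
  · rw [Finset.mem_filter, Finset.mem_powersetCard] at hT'
    obtain ⟨j, hj, rfl⟩ := (Finset.exists_eq_insert_iff (s := Tᶜ) (t := T')).2
      ⟨fun a ha => by
        have : a ∈ T ∪ T' := hT'.2 ▸ Finset.mem_univ a
        simpa [Finset.mem_compl.1 ha] using this, by rw [hc, hT'.1.2]⟩
    exact ⟨j, by simpa using hj, rfl⟩

variable (h : r + 1 + (r + 1) = 2 * r + 1 + 1)

/-- The inputs in `T` enter `μ^r` and those in `Tᶜ` enter `β`; Leibniz lets each `j ∈ T` in turn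
join `Tᶜ` in the bracket. -/
theorem act_beta_circ_muPow (σ : Equiv.Perm (Fin (2 * r + 1))) (T : Finset (Fin (2 * r + 1)))
    (hT : ∀ q, q ∈ T ↔ (σ q).1 < r + 1) :
    (uGerst K r).act σ ((uGerst K r).circ 0 h (beta K r) (muPow K r r)) =
      ∑ j ∈ T, bracketOf K r r h (insert j Tᶜ) := by
  rw [beta_circ_muPow K r h h, map_sum]
  refine Finset.sum_bij (fun i _ => σ⁻¹ ⟨i.1, by omega⟩) (fun i _ => ?_) (fun i _ j _ hij => ?_)
    (fun j hj => ?_) fun i _ => act_bracketOf K r h σ fun q => ?_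
  · rw [hT, perm_apply_inv_self]
    exact i.2
  · simpa [Fin.ext_iff] using hij
  · exact ⟨⟨(σ j).1, (hT j).1 hj⟩, Finset.mem_univ _, σ.symm_apply_apply j⟩
  · rw [mem_pickedSet, Finset.mem_insert, Finset.mem_compl, hT, Equiv.Perm.eq_inv_iff_eq,
      Fin.ext_iff]
    simp only [not_lt]
    omega

/-- The mixed terms of the Jacobi relation for the coproduct of the bracket cancel. -/
theorem sum_unshuffles_mixed :
    ∑ σ ∈ UGerst.unshuffles r,
      (uGerst K r).act σ ((uGerst K r).circ 0 h (beta K r) (muPow K r r)) ⊗ₜ[K]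
        (uGerst K r).act σ ((uGerst K r).circ 0 h (muPow K r r) (beta K r)) =
    ∑ σ ∈ UGerst.unshuffles r,
      (uGerst K r).act σ ((uGerst K r).circ 0 h (muPow K r r) (beta K r)) ⊗ₜ[K]
        (uGerst K r).act σ ((uGerst K r).circ 0 h (beta K r) (muPow K r r)) := by
  rw [sum_unshuffles r _ (fun T => (∑ j ∈ T, bracketOf K r r h (insert j Tᶜ)) ⊗ₜ
      bracketOf K r r h T) fun σ => by
        rw [act_beta_circ_muPow K r h σ (Finset.univ.filter fun q => (σ q).1 < r + 1) (by simp),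
          act_muPow_circ_beta K r h σ (T := Finset.univ.filter fun q => (σ q).1 < r + 1) (by simp)],
    sum_unshuffles r _ (fun T => bracketOf K r r h T ⊗ₜ
      (∑ j ∈ T, bracketOf K r r h (insert j Tᶜ))) fun σ => by
        rw [act_beta_circ_muPow K r h σ (Finset.univ.filter fun q => (σ q).1 < r + 1) (by simp),
          act_muPow_circ_beta K r h σ (T := Finset.univ.filter fun q => (σ q).1 < r + 1) (by simp)]]
  have hl : ∀ T ∈ Finset.powersetCard (r + 1) Finset.univ,
      (∑ j ∈ T, bracketOf K r r h (insert j Tᶜ)) ⊗ₜ[K] bracketOf K r r h T =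
        ∑ T' ∈ Finset.powersetCard (r + 1) Finset.univ, if T ∪ T' = Finset.univ then
          bracketOf K r r h T' ⊗ₜ[K] bracketOf K r r h T else 0 := fun T hT => by
    rw [TensorProduct.sum_tmul]
    exact sum_insert_compl r (Finset.mem_powersetCard.1 hT).2
      fun T' => bracketOf K r r h T' ⊗ₜ[K] bracketOf K r r h T
  have hr : ∀ T ∈ Finset.powersetCard (r + 1) Finset.univ,
      bracketOf K r r h T ⊗ₜ[K] (∑ j ∈ T, bracketOf K r r h (insert j Tᶜ)) =
        ∑ T' ∈ Finset.powersetCard (r + 1) Finset.univ, if T ∪ T' = Finset.univ then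
          bracketOf K r r h T ⊗ₜ[K] bracketOf K r r h T' else 0 := fun T hT => by
    rw [TensorProduct.tmul_sum]
    exact sum_insert_compl r (Finset.mem_powersetCard.1 hT).2
      fun T' => bracketOf K r r h T ⊗ₜ[K] bracketOf K r r h T'
  -- Both sides are now sums over pairs covering all inputs, with the roles of `T` and `T'`
  -- exchanged.
  rw [Finset.sum_congr rfl hl, Finset.sum_congr rfl hr, Finset.sum_comm]
  refine Finset.sum_congr rfl fun T _ => Finset.sum_congr rfl fun T' _ => ?_
  rw [Finset.union_comm]

/-! ### The coproduct as a morphism of operads -/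

/-- The coproduct of the generators. -/
noncomputable def comulGen : ∀ n, UGerstGen r n →
    (hadamard (uGerst K r) (uGerst K r)).obj n
  | _, .u => u K r ⊗ₜ u K r
  | _, .mu => mu K r ⊗ₜ mu K r
  | _, .beta => muPow K r r ⊗ₜ beta K r + beta K r ⊗ₜ muPow K r r

theorem comulGen_mem (n : ℕ) (x : UGerstGen r n) :
    comulGen K r n x ∈ (hadamard (uGerst K r) (uGerst K r)).gr n (UGerst.deg r n x) := by
  cases x with
  | u => exact tmul_mem_tensorGr (add_zero 0) (u_mem K r) (u_mem K r)
  | mu => exact tmul_mem_tensorGr (add_zero 0) (mu_mem K r) (mu_mem K r)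
  | beta =>
    exact add_mem (tmul_mem_tensorGr (zero_add 1) (muPow_mem K r r) (beta_mem K r))
      (tmul_mem_tensorGr (add_zero 1) (beta_mem K r) (muPow_mem K r r))

/-- The composite of homogeneous tensors, when no sign appears. -/
theorem hadamard_circ_of_left {P Q : GradedOperad K} {n m l : ℕ} (i : Fin n) (h : n + m = l + 1)
    {f : ℤ} (a : P.obj n) {b : Q.obj n} {c : P.obj m} (d : Q.obj m) (hb : b ∈ Q.gr n 0)
    (hc : c ∈ P.gr m f) : (hadamard P Q).circ i h (a ⊗ₜ b) (c ⊗ₜ d) =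
      P.circ i h a c ⊗ₜ[K] Q.circ i h b d :=
  (hadamardCirc_tmul P Q i h a d hb hc).trans (by simp)

theorem hadamard_circ_of_right {P Q : GradedOperad K} {n m l : ℕ} (i : Fin n) (h : n + m = l + 1)
    {e : ℤ} (a : P.obj n) {b : Q.obj n} {c : P.obj m} (d : Q.obj m) (hb : b ∈ Q.gr n e)
    (hc : c ∈ P.gr m 0) : (hadamard P Q).circ i h (a ⊗ₜ b) (c ⊗ₜ d) =
      P.circ i h a c ⊗ₜ[K] Q.circ i h b d :=
  (hadamardCirc_tmul P Q i h a d hb hc).trans (by simp)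

local notation "HH" => hadamard (uGerst K r) (uGerst K r)

theorem comulGen_jacobi : ∑ σ ∈ UGerst.unshuffles r, (HH).act σ
    ((HH).circ 0 (by omega) (comulGen K r _ .beta) (comulGen K r _ .beta)) =
      (0 : (HH).obj (2 * r + 1)) := by
  have e : ((HH).circ 0 h (comulGen K r _ .beta) (comulGen K r _ .beta) : (HH).obj (2 * r + 1)) =
      (uGerst K r).circ 0 h (muPow K r r) (muPow K r r) ⊗ₜ
        (uGerst K r).circ 0 h (beta K r) (beta K r) -
      (uGerst K r).circ 0 h (muPow K r r) (beta K r) ⊗ₜ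
        (uGerst K r).circ 0 h (beta K r) (muPow K r r) +
      ((uGerst K r).circ 0 h (beta K r) (muPow K r r) ⊗ₜ
        (uGerst K r).circ 0 h (muPow K r r) (beta K r) +
      (uGerst K r).circ 0 h (beta K r) (beta K r) ⊗ₜ
        (uGerst K r).circ 0 h (muPow K r r) (muPow K r r)) := by
    simp only [comulGen, map_add, LinearMap.add_apply]
    rw [hadamard_circ_of_right K 0 h _ _ (beta_mem K r) (muPow_mem K r r),
      hadamard_circ_of_left K 0 h _ _ (muPow_mem K r r) (muPow_mem K r r),
      hadamard_circ_of_left K 0 h _ _ (muPow_mem K r r) (beta_mem K r)]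
    -- The one term where two elements of degree `1` pass each other; its sign `-1` makes the mixed
    -- terms cancel.
    have := hadamardCirc_tmul (uGerst K r) (uGerst K r) 0 h (muPow K r r) (muPow K r r)
      (beta_mem K r) (beta_mem K r)
    rw [mul_one, koszulSign_one, neg_one_smul] at this
    rw [TensorProduct.curry_apply, this]
    abel
  rw [e]
  simp only [map_add, map_sub, TensorProduct.map_tmul, Finset.sum_add_distrib,
    Finset.sum_sub_distrib, act_muPow_circ_muPow]
  -- Permutations fix the factor `μ^r ∘ μ^r`, so it leaves the sum and the Jacobi relation applies
  -- to the other factor.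
  rw [← TensorProduct.tmul_sum, ← TensorProduct.sum_tmul, jacobi, sum_unshuffles_mixed]
  simp

theorem eval_comulGen (n : ℕ) (x : Comb K (UGerstGen r) n) (hx : UGerst.IsRel K r n x) :
    (UGerst.presentation K r).eval HH (comulGen K r) n x = 0 := by
  have hu : (UGerst.presentation K r).eval HH (comulGen K r) 0 (UGerst.u K r) = _ :=
    eval_single (Q := UGerst.presentation K r) (.gen UGerstGen.u)
  have hm : (UGerst.presentation K r).eval HH (comulGen K r) 2 (UGerst.mu K r) = _ :=
    eval_single (Q := UGerst.presentation K r) (.gen UGerstGen.mu)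
  have hb : (UGerst.presentation K r).eval HH (comulGen K r) (r + 1) (UGerst.beta K r) = _ :=
    eval_single (Q := UGerst.presentation K r) (.gen UGerstGen.beta)
  cases hx with
  | mu_symm σ =>
    refine (map_sub _ _ _).trans (sub_eq_zero.2 ((eval_actC σ _).trans ?_))
    rw [hm]
    simp only [termValue, comulGen, TensorProduct.map_tmul, act_mu]
  | beta_symm σ =>
    refine (map_sub _ _ _).trans (sub_eq_zero.2 ((eval_actC σ _).trans ?_))
    rw [hb]
    simp only [termValue, comulGen, map_add, TensorProduct.map_tmul, act_beta, act_muPow]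
  | unit_mu =>
    refine (map_sub _ _ _).trans (sub_eq_zero.2 ((eval_circC _ _ _ _).trans ?_))
    rw [hm, hu]
    refine (hadamard_circ_of_left K 0 _ _ _ (mu_mem K r) (u_mem K r)).trans ?_
    rw [mu_circ_u]
    exact (eval_single (Q := UGerst.presentation K r) (O := HH)
      (g := comulGen K r) .one).symm
  | unit_beta =>
    refine (eval_circC _ _ _ _).trans ?_
    rw [hb, hu]
    simp only [termValue, comulGen, map_add, LinearMap.add_apply]
    rw [hadamard_circ_of_right K 0 _ _ _ (beta_mem K r) (u_mem K r),
      hadamard_circ_of_right K 0 _ _ _ (muPow_mem K r r) (u_mem K r), beta_circ_u]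
    simp
  | assoc =>
    refine (map_sub _ _ _).trans (sub_eq_zero.2 ((eval_circC _ _ _ _).trans
      (Eq.trans ?_ (eval_circC _ _ _ _).symm)))
    rw [hm]
    refine (hadamard_circ_of_left K 0 _ _ _ (mu_mem K r) (mu_mem K r)).trans
      (Eq.trans ?_ (hadamard_circ_of_left K 1 _ _ _ (mu_mem K r) (mu_mem K r)).symm)
    rw [mu_assoc]
  | leibniz =>
    refine (map_sub _ _ _).trans (sub_eq_zero.2 ((eval_circC _ _ _ _).trans
      (Eq.trans ?_ ((map_add _ _ _).trans (congrArg₂ (· + ·) ((eval_actC _ _).trans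
        (congrArg _ (eval_circC _ _ _ _))) (eval_circC _ _ _ _))).symm)))
    rw [hm, hb]
    have h₁ : r + 1 + 2 = r + 2 + 1 := by omega
    have h₂ : 2 + (r + 1) = r + 2 + 1 := by omega
    simp only [termValue, comulGen, map_add, LinearMap.add_apply]
    -- In the tensor factor without `β` all three composites equal the symmetric `μ^(r+1)`, so the
    -- Leibniz relation in the other factor suffices.
    rw [hadamard_circ_of_right K 0 h₁ _ _ (beta_mem K r) (mu_mem K r),
      hadamard_circ_of_right K 0 h₁ _ _ (muPow_mem K r r) (mu_mem K r),
      hadamard_circ_of_left K 0 h₂ _ _ (mu_mem K r) (muPow_mem K r r),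
      hadamard_circ_of_left K 0 h₂ _ _ (mu_mem K r) (beta_mem K r),
      hadamard_circ_of_left K 1 h₂ _ _ (mu_mem K r) (muPow_mem K r r),
      hadamard_circ_of_left K 1 h₂ _ _ (mu_mem K r) (beta_mem K r),
      TensorProduct.map_tmul, TensorProduct.map_tmul, mu_circ_zero_muPow, mu_circ_one_muPow,
      act_muPow, leibniz, TensorProduct.tmul_add, TensorProduct.add_tmul]
    have : (uGerst K r).circ 0 h₁ (muPow K r r) (mu K r) = muPow K r (r + 1) := rfl
    rw [this]
    abel
  | jacobi =>
    refine (map_sum _ _ _).trans (Eq.trans (Finset.sum_congr rfl fun σ _ => ?_)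
      (comulGen_jacobi K r (by omega)))
    refine (eval_actC _ _).trans (congrArg _ ((eval_circC _ _ _ _).trans ?_))
    rw [hb]
    rfl

/-- The coproduct. -/
noncomputable def comulHom : Hom (uGerst K r) HH :=
  lift (Q := UGerst.presentation K r) (comulGen_mem K r) (eval_comulGen K r)

theorem comulHom_u : (comulHom K r).app 0 (u K r) = u K r ⊗ₜ u K r :=
  lift_ofGen (Q := UGerst.presentation K r) _ _ UGerstGen.u

theorem comulHom_mu : (comulHom K r).app 2 (mu K r) = mu K r ⊗ₜ mu K r :=
  lift_ofGen (Q := UGerst.presentation K r) _ _ UGerstGen.mu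

theorem comulHom_beta : (comulHom K r).app (r + 1) (beta K r) =
    muPow K r r ⊗ₜ beta K r + beta K r ⊗ₜ muPow K r r :=
  lift_ofGen (Q := UGerst.presentation K r) _ _ UGerstGen.beta

/-- Powers of `μ` are group-like, which is what coassociativity on `β` needs. -/
theorem comulHom_muPow (p : ℕ) :
    (comulHom K r).app (p + 1) (muPow K r p) = muPow K r p ⊗ₜ muPow K r p := by
  induction p with
  | zero => exact (comulHom K r).app_one
  | succ p ih =>
    refine ((comulHom K r).app_circ _ _ _ _).trans ?_
    rw [ih, comulHom_mu]
    exact hadamard_circ_of_left K 0 _ _ _ (muPow_mem K r p) (mu_mem K r)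

/-! ### The counit as a morphism of operads -/

/-- The counit of the generators. -/
def counitGen : ∀ n, UGerstGen r n → (uCom K).obj n
  | _, .u => (1 : K)
  | _, .mu => (1 : K)
  | _, .beta => (0 : K)

theorem counitGen_mem (n : ℕ) (x : UGerstGen r n) :
    counitGen K r n x ∈ (uCom K).gr n (UGerst.deg r n x) := by
  cases x with
  | u => exact mem_groundGr_zero 1
  | mu => exact mem_groundGr_zero 1
  | beta => exact zero_mem _

theorem eval_counitGen (n : ℕ) (x : Comb K (UGerstGen r) n) (hx : UGerst.IsRel K r n x) :
    (UGerst.presentation K r).eval (uCom K) (counitGen K r) n x = 0 := by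
  have hu : (UGerst.presentation K r).eval (uCom K) (counitGen K r) 0 (UGerst.u K r) = (1 : K) :=
    eval_single (Q := UGerst.presentation K r) (.gen UGerstGen.u)
  have hm : (UGerst.presentation K r).eval (uCom K) (counitGen K r) 2 (UGerst.mu K r) = (1 : K) :=
    eval_single (Q := UGerst.presentation K r) (.gen UGerstGen.mu)
  have hb : (UGerst.presentation K r).eval (uCom K) (counitGen K r) (r + 1) (UGerst.beta K r) =
      (0 : K) := eval_single (Q := UGerst.presentation K r) (.gen UGerstGen.beta)
  cases hx with
  | mu_symm σ => exact (map_sub _ _ _).trans (sub_eq_zero.2 (eval_actC σ _))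
  | beta_symm σ => exact (map_sub _ _ _).trans (sub_eq_zero.2 (eval_actC σ _))
  | unit_mu =>
    refine (map_sub _ _ _).trans (sub_eq_zero.2 ((eval_circC _ _ _ _).trans ?_))
    rw [hm, hu]
    exact (one_mul (1 : K)).trans (eval_single (Q := UGerst.presentation K r) (O := uCom K)
      (g := counitGen K r) .one).symm
  | unit_beta =>
    refine (eval_circC _ _ _ _).trans ?_
    rw [hb]
    exact zero_mul _
  | assoc =>
    refine (map_sub _ _ _).trans (sub_eq_zero.2 ((eval_circC _ _ _ _).trans
      (Eq.trans ?_ (eval_circC _ _ _ _).symm)))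
    rfl
  | leibniz =>
    refine (map_sub _ _ _).trans (sub_eq_zero.2 ((eval_circC _ _ _ _).trans
      (Eq.trans ?_ ((map_add _ _ _).trans (congrArg₂ (· + ·) ((eval_actC _ _).trans
        (congrArg _ (eval_circC _ _ _ _))) (eval_circC _ _ _ _))).symm)))
    rw [hb]
    simp
  | jacobi =>
    refine (map_sum _ _ _).trans (Finset.sum_eq_zero fun σ _ => ?_)
    refine (eval_actC _ _).trans ((eval_circC _ _ _ _).trans ?_)
    rw [hb]
    exact zero_mul _

/-- The counit. -/
noncomputable def counitHom : Hom (uGerst K r) (uCom K) :=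
  lift (Q := UGerst.presentation K r) (counitGen_mem K r) (eval_counitGen K r)

theorem counitHom_u : (counitHom K r).app 0 (u K r) = (1 : K) :=
  lift_ofGen (Q := UGerst.presentation K r) _ _ UGerstGen.u

theorem counitHom_mu : (counitHom K r).app 2 (mu K r) = (1 : K) :=
  lift_ofGen (Q := UGerst.presentation K r) _ _ UGerstGen.mu

theorem counitHom_beta : (counitHom K r).app (r + 1) (beta K r) = (0 : K) :=
  lift_ofGen (Q := UGerst.presentation K r) _ _ UGerstGen.beta

theorem counitHom_muPow (p : ℕ) : (counitHom K r).app (p + 1) (muPow K r p) = (1 : K) := by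
  induction p with
  | zero => exact (counitHom K r).app_one
  | succ p ih =>
    refine ((counitHom K r).app_circ _ _ _ _).trans ?_
    rw [ih, counitHom_mu]
    exact one_mul 1

variable {K r} in
theorem hom_ext_gen {O : GradedOperad K} {f f' : Hom (uGerst K r) O}
    (hu : f.app 0 (u K r) = f'.app 0 (u K r)) (hm : f.app 2 (mu K r) = f'.app 2 (mu K r))
    (hb : f.app (r + 1) (beta K r) = f'.app (r + 1) (beta K r)) (n : ℕ) : f.app n = f'.app n :=
  hom_ext (Q := UGerst.presentation K r) (fun n (x : UGerstGen r n) => by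
    cases x with
    | u => exact hu
    | mu => exact hm
    | beta => exact hb) n

/-! ### The coalgebra axioms, checked on generators -/

/-- The coproduct of the operations of arity `n`. -/
noncomputable def comul (n : ℕ) :
    (uGerst K r).obj n →ₗ[K] (uGerst K r).obj n ⊗[K] (uGerst K r).obj n :=
  (comulHom K r).app n

/-- The counit of the operations of arity `n`. -/
noncomputable def counit (n : ℕ) : (uGerst K r).obj n →ₗ[K] K := (counitHom K r).app n

theorem comul_u : comul K r 0 (u K r) = u K r ⊗ₜ u K r := comulHom_u K r

theorem comul_mu : comul K r 2 (mu K r) = mu K r ⊗ₜ mu K r := comulHom_mu K r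

theorem comul_beta : comul K r (r + 1) (beta K r) =
    muPow K r r ⊗ₜ beta K r + beta K r ⊗ₜ muPow K r r := comulHom_beta K r

theorem comul_muPow (p : ℕ) : comul K r (p + 1) (muPow K r p) = muPow K r p ⊗ₜ muPow K r p :=
  comulHom_muPow K r p

theorem counit_u : counit K r 0 (u K r) = 1 := counitHom_u K r

theorem counit_mu : counit K r 2 (mu K r) = 1 := counitHom_mu K r

theorem counit_beta : counit K r (r + 1) (beta K r) = 0 := counitHom_beta K r

theorem counit_muPow (p : ℕ) : counit K r (p + 1) (muPow K r p) = 1 := counitHom_muPow K r p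

/-- Both sides are operad morphisms into the threefold Hadamard product. On `β` each is the sum of
the three tensors with `β` in one slot and `μ^r` in the other two. -/
theorem comul_coassoc (n : ℕ) :
    (TensorProduct.assoc K _ _ _).toLinearMap ∘ₗ (comul K r n).rTensor _ ∘ₗ comul K r n =
      (comul K r n).lTensor _ ∘ₗ comul K r n := by
  refine hom_ext_gen (f := (Hom.assoc _ _ _).comp
    ((Hom.map (comulHom K r) (Hom.id _)).comp (comulHom K r)))
    (f' := (Hom.map (Hom.id _) (comulHom K r)).comp (comulHom K r)) ?_ ?_ ?_ n
  · change TensorProduct.assoc K _ _ _ ((comul K r 0).rTensor _ (comul K r 0 (u K r))) =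
      (comul K r 0).lTensor _ (comul K r 0 (u K r))
    simp only [comul_u, LinearMap.rTensor_tmul, LinearMap.lTensor_tmul,
      TensorProduct.assoc_tmul]
  · change TensorProduct.assoc K _ _ _ ((comul K r 2).rTensor _ (comul K r 2 (mu K r))) =
      (comul K r 2).lTensor _ (comul K r 2 (mu K r))
    simp only [comul_mu, LinearMap.rTensor_tmul, LinearMap.lTensor_tmul,
      TensorProduct.assoc_tmul]
  · change TensorProduct.assoc K _ _ _ ((comul K r (r + 1)).rTensor _
      (comul K r (r + 1) (beta K r))) =
      (comul K r (r + 1)).lTensor _ (comul K r (r + 1) (beta K r))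
    simp only [comul_beta, comul_muPow, map_add, TensorProduct.add_tmul, TensorProduct.tmul_add,
      add_assoc, LinearMap.rTensor_tmul, LinearMap.lTensor_tmul,
      TensorProduct.assoc_tmul]

theorem rTensor_counit_comp_comul (n : ℕ) :
    (counit K r n).rTensor _ ∘ₗ comul K r n = TensorProduct.mk K K _ 1 := by
  refine hom_ext_gen (f := (Hom.map (counitHom K r) (Hom.id _)).comp (comulHom K r))
    (f' := Hom.oneTmul _) ?_ ?_ ?_ n
  · change (counit K r 0).rTensor _ (comul K r 0 (u K r)) = 1 ⊗ₜ u K r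
    simp only [comul_u, counit_u, LinearMap.rTensor_tmul]
  · change (counit K r 2).rTensor _ (comul K r 2 (mu K r)) = 1 ⊗ₜ mu K r
    simp only [comul_mu, counit_mu, LinearMap.rTensor_tmul]
  · change (counit K r (r + 1)).rTensor _ (comul K r (r + 1) (beta K r)) = 1 ⊗ₜ beta K r
    simp only [comul_beta, counit_beta, counit_muPow, map_add, TensorProduct.zero_tmul, add_zero,
      LinearMap.rTensor_tmul]

theorem lTensor_counit_comp_comul (n : ℕ) :
    (counit K r n).lTensor _ ∘ₗ comul K r n = (TensorProduct.mk K _ K).flip 1 := by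
  refine hom_ext_gen (f := (Hom.map (Hom.id _) (counitHom K r)).comp (comulHom K r))
    (f' := Hom.tmulOne _) ?_ ?_ ?_ n
  · change (counit K r 0).lTensor _ (comul K r 0 (u K r)) = u K r ⊗ₜ 1
    simp only [comul_u, counit_u, LinearMap.lTensor_tmul]
  · change (counit K r 2).lTensor _ (comul K r 2 (mu K r)) = mu K r ⊗ₜ 1
    simp only [comul_mu, counit_mu, LinearMap.lTensor_tmul]
  · change (counit K r (r + 1)).lTensor _ (comul K r (r + 1) (beta K r)) = beta K r ⊗ₜ 1
    simp only [comul_beta, counit_beta, counit_muPow, map_add, TensorProduct.tmul_zero, zero_add,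
      LinearMap.lTensor_tmul]

/-- The braiding is a morphism of operads, so generators suffice. On `β` it exchanges the two
summands without sign, as `μ^r` has degree `0`. -/
theorem koszul_comul (n : ℕ) (x : (uGerst K r).obj n) :
    koszul ((uGerst K r).gr n) ((uGerst K r).gr n) (comul K r n x) = comul K r n x := by
  refine LinearMap.congr_fun (hom_ext_gen (f := (Hom.swap _ _).comp (comulHom K r))
    (f' := comulHom K r) ?_ ?_ ?_ n) x
  · change koszul ((uGerst K r).gr 0) ((uGerst K r).gr 0) (comul K r 0 (u K r)) =
      comul K r 0 (u K r)
    rw [comul_u, koszul_tmul_sign _ _ (u_mem K r) (u_mem K r), mul_zero, koszulSign_zero,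
      one_smul]
  · change koszul ((uGerst K r).gr 2) ((uGerst K r).gr 2) (comul K r 2 (mu K r)) =
      comul K r 2 (mu K r)
    rw [comul_mu, koszul_tmul_sign _ _ (mu_mem K r) (mu_mem K r), mul_zero, koszulSign_zero,
      one_smul]
  · change koszul ((uGerst K r).gr (r + 1)) ((uGerst K r).gr (r + 1))
      (comul K r (r + 1) (beta K r)) = comul K r (r + 1) (beta K r)
    rw [comul_beta, map_add, koszul_tmul_sign _ _ (beta_mem K r) (muPow_mem K r r),
      koszul_tmul_sign _ _ (muPow_mem K r r) (beta_mem K r), mul_zero, zero_mul, koszulSign_zero,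
      one_smul, one_smul]
    exact add_comm _ _

/-- The coalgebra structure on the operations of arity `n`. -/
noncomputable abbrev coalgebra (n : ℕ) : Coalgebra K ((uGerst K r).obj n) where
  comul := comul K r n
  counit := counit K r n
  coassoc := comul_coassoc K r n
  rTensor_counit_comp_comul := rTensor_counit_comp_comul K r n
  lTensor_counit_comp_comul := lTensor_counit_comp_comul K r n

/-- The Hopf structure on the operad of unital `r`-Gerstenhaber algebras. -/
noncomputable def hopfStructure : CocommHopfStructure (uGerst K r) where
  coalgebra := coalgebra K r
  comul_mem _ _ _ hx := (comulHom K r).app_mem hx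
  counit_eq_zero _ _ _ hx hd := eq_zero_of_mem_groundGr hd ((counitHom K r).app_mem hx)
  cocomm := koszul_comul K r
  comul_act σ x := (comulHom K r).app_act σ x
  counit_act σ x := (counitHom K r).app_act σ x
  -- For equal operads `hadamardCirc` is by definition `circTensor`.
  comul_circ i h x y := (comulHom K r).app_circ i h x y
  counit_circ i h x y := (counitHom K r).app_circ i h x y
  comul_one := (comulHom K r).app_one
  counit_one := (counitHom K r).app_one

end uGerst

/-! ### Uniqueness and the main theorem -/

/-- The counit of a coalgebra is determined by the coproduct. -/
theorem Coalgebra.ext_of_comul {K M : Type*} [Field K] [AddCommGroup M] [Module K M]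
    {c c' : Coalgebra K M} (h : c.comul = c'.comul) : c = c' := by
  obtain @⟨⟨Δ, ε⟩, _, h₁, _⟩ := c
  obtain @⟨⟨Δ', ε'⟩, _, _, h₂⟩ := c'
  obtain rfl : Δ = Δ' := h
  suffices ε = ε' by subst this; rfl
  ext x
  have e₁ : ε.rTensor M (Δ x) = 1 ⊗ₜ x := LinearMap.congr_fun h₁ x
  have e₂ : ε'.lTensor M (Δ x) = x ⊗ₜ 1 := LinearMap.congr_fun h₂ x
  -- Evaluate `(ε ⊗ ε')(Δ x)` in two ways: the left counit law for `ε` yields `ε' x`, the right one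
  -- for `ε'` yields `ε x`.
  have e : ε'.lTensor K (ε.rTensor M (Δ x)) = ε.rTensor K (ε'.lTensor M (Δ x)) :=
    LinearMap.congr_fun (f := ε'.lTensor K ∘ₗ ε.rTensor M) (g := ε.rTensor K ∘ₗ ε'.lTensor M)
      (TensorProduct.ext' fun _ _ => rfl) (Δ x)
  rw [e₁, e₂, LinearMap.lTensor_tmul, LinearMap.rTensor_tmul] at e
  simpa using (congrArg (TensorProduct.lid K K) e).symm

namespace CocommHopfStructure

variable {K : Type*} [Field K] {P : GradedOperad K}

theorem ext_of_comul {H H' : CocommHopfStructure P}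
    (h : ∀ n, (H.coalgebra n).comul = (H'.coalgebra n).comul) : H = H' := by
  obtain ⟨c⟩ := H
  obtain ⟨c'⟩ := H'
  obtain rfl : c = c' := funext fun n => Coalgebra.ext_of_comul (h n)
  rfl

/-- The coproduct of a Hopf operad, as a morphism of operads. -/
noncomputable def comulHom (H : CocommHopfStructure P) :
    GradedOperad.Hom P (GradedOperad.hadamard P P) where
  app n := (H.coalgebra n).comul
  app_mem h := H.comul_mem _ _ _ h
  app_act := H.comul_act
  app_circ := H.comul_circ
  app_one := H.comul_one

end CocommHopfStructure

theorem mainTheorem12 (K : Type*) [Field K] (k : ℕ) (hk : 2 ≤ k) :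
    ∃! H : CocommHopfStructure (uGerst K (k - 1)),
      (H.coalgebra 0).comul (uGerst.u K (k - 1)) = uGerst.u K (k - 1) ⊗ₜ[K] uGerst.u K (k - 1) ∧
      (H.coalgebra 2).comul (uGerst.mu K (k - 1)) =
        uGerst.mu K (k - 1) ⊗ₜ[K] uGerst.mu K (k - 1) ∧
      (H.coalgebra (k - 1 + 1)).comul (uGerst.beta K (k - 1)) =
        uGerst.muPow K (k - 1) (k - 1) ⊗ₜ[K] uGerst.beta K (k - 1) +
          uGerst.beta K (k - 1) ⊗ₜ[K] uGerst.muPow K (k - 1) (k - 1) := by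
  refine ⟨uGerst.hopfStructure K (k - 1), ⟨uGerst.comulHom_u K (k - 1),
    uGerst.comulHom_mu K (k - 1), uGerst.comulHom_beta K (k - 1)⟩, ?_⟩
  rintro H ⟨hu, hm, hb⟩
  exact CocommHopfStructure.ext_of_comul (uGerst.hom_ext_gen (f := H.comulHom)
    (f' := uGerst.comulHom K (k - 1)) (hu.trans (uGerst.comulHom_u K _).symm)
    (hm.trans (uGerst.comulHom_mu K _).symm) (hb.trans (uGerst.comulHom_beta K _).symm))
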